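/- Let $n\ge 3$ be an integer and let $s_1,s_2\in\mathbb{R}$ satisfy $1<s_1<\tfrac n2$ and $s_1\le s_2$. Let $C^\infty_{c,r}(\mathbb{R}^n)$ denote the space of smooth, compactly supported, radial, complex-valued functions on $\mathbb{R}^n$. With $\mathcal{F}u(\xi)=(2\pi)^{-n/2}\int_{\mathbb{R}^n}u(x)e^{-i\xi\cdot x}\,dx$, put $$\langle u,v\rangle_{\dot H^s}=\big\langle |\cdot|^s\mathcal{F}u,|\cdot|^s\mathcal{F}v\big\rangle_{L^2(\mathbb{R}^n)},\qquad \langle u,v\rangle_{\dot H^{a}\cap\dot H^{b}}=\langle u,v\rangle_{\dot H^{a}}+\mathbf{1}_{(0,\infty)}(b-a)\,\langle u,v\rangle_{\dot H^{b}}\quad(0\le a\le b),$$ and let $\mathcal{H}^{s_1,s_2}$ be the completion of $C^\infty_{c,r}(\mathbb{R}^n)\times C^\infty_{c,r}(\mathbb{R}^n)$ with respect to the norm induced by the inner product $$\langle \mathbf u,\mathbf v\rangle_{\mathcal{H}^{s_1,s_2}}=\langle u_1,v_1\rangle_{\dot H^{s_1}\cap\dot H^{s_2}}+\langle u_2,v_2\rangle_{\dot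 H^{s_1-1}\cap\dot H^{s_2-1}}.$$ Let $\Lambda f(x)=\sum_{i=1}^n x_i\,\partial_i f(x)$, and consider on the domain $\mathcal{D}(\widetilde{\mathbf L}_0)=C^\infty_{c,r}(\mathbb{R}^n)\times C^\infty_{c,r}(\mathbb{R}^n)$ the operator $$\widetilde{\mathbf L}_0(u_1,u_2)=\big(-\Lambda u_1-2u_1+u_2,\ \Delta u_1-\Lambda u_2-3u_2\big).$$ Then $\widetilde{\mathbf L}_0:\mathcal{D}(\widetilde{\mathbf L}_0)\subseteq\mathcal{H}^{s_1,s_2}\to\mathcal{H}^{s_1,s_2}$ is closable, and its closure generates a strongly continuous semigroup $(\mathbf S_0(\tau))_{\tau\ge0}$ of bounded linear operators on $\mathcal{H}^{s_1,s_2}$. Furthermore, $$\|\mathbf S_0(\tau)\mathbf u\|_{\mathcal{H}^{s_1,s_2}}\le e^{(\frac n2-2-s_1)\tau}\,\|\mathbf u\|_{\mathcal{H}^{s_1,s_2}}$$ for all $\mathbf u\in\mathcal{H}^{s_1,s_2}$ and all $\tau\ge 0$. -/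

import Mathlib

open MeasureTheory Filter Topology
open scoped ContDiff NNReal InnerProductSpace ComplexConjugate FourierTransform

noncomputable section

namespace SimilarityWave

/-- Euclidean space `ℝⁿ`. -/
abbrev Rn (n : ℕ) : Type := EuclideanSpace ℝ (Fin n)

lemma two_le_smooth : (2 : WithTop ℕ∞) ≤ ∞ := WithTop.coe_le_coe.2 (le_top (a := (2 : ℕ∞)))

/-! ### Radial test functions -/

/-- The space `C^∞_{c,r}(ℝⁿ)` of smooth, compactly supported, radial, complex-valued functions. -/
def radialTest (n : ℕ) : Submodule ℂ (Rn n → ℂ) where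
  carrier := {f | ContDiff ℝ ∞ f ∧ HasCompactSupport f ∧ ∀ x y : Rn n, ‖x‖ = ‖y‖ → f x = f y}
  add_mem' := by
    rintro f g ⟨hf, hf', hf''⟩ ⟨hg, hg', hg''⟩
    exact ⟨hf.add hg, hf'.add hg', fun x y h => by simp [hf'' x y h, hg'' x y h]⟩
  zero_mem' := ⟨contDiff_const, HasCompactSupport.zero, fun _ _ _ => rfl⟩
  smul_mem' := by
    rintro c f ⟨hf, hf', hf''⟩
    exact ⟨hf.const_smul c, hf'.smul_left (f := fun _ => c),
      fun x y h => by simp [hf'' x y h]⟩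

/-! ### Fourier transform and homogeneous Sobolev inner products -/

/-- The unitary Fourier transform
`𝓕u(ξ) = (2π)^{-n/2} ∫ u(x) e^{-i ξ·x} dx`. -/
def fourierU {n : ℕ} (u : Rn n → ℂ) (ξ : Rn n) : ℂ :=
  (((2 * Real.pi) ^ (-(n : ℝ) / 2) : ℝ) : ℂ) *
    ∫ x : Rn n, u x * Complex.exp (-Complex.I * ((⟪ξ, x⟫_ℝ : ℝ) : ℂ))

/-- The inner product `⟨u,v⟩_{Ḣ^s} = ⟨|·|^s 𝓕u, |·|^s 𝓕v⟩_{L²}`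
(conjugate-linear in the first argument). -/
def homInner {n : ℕ} (s : ℝ) (u v : Rn n → ℂ) : ℂ :=
  ∫ ξ : Rn n, conj (((‖ξ‖ ^ s : ℝ) : ℂ) * fourierU u ξ) * (((‖ξ‖ ^ s : ℝ) : ℂ) * fourierU v ξ)

open Classical in
/-- The inner product of `Ḣ^{s₁} ∩ Ḣ^{s₂}`; the second summand is present only if `s₁ < s₂`. -/
def interInner {n : ℕ} (s₁ s₂ : ℝ) (u v : Rn n → ℂ) : ℂ :=
  homInner s₁ u v + if s₁ < s₂ then homInner s₂ u v else 0

/-- The Schwartz function given by a radial test function. -/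
def toSchwartz {n : ℕ} (u : radialTest n) : SchwartzMap (Rn n) ℂ :=
  u.2.2.1.toSchwartzMap u.2.1

lemma fourierU_eq {n : ℕ} (u : radialTest n) (ξ : Rn n) :
    fourierU (u : Rn n → ℂ) ξ = (((2 * Real.pi) ^ (-(n : ℝ) / 2) : ℝ) : ℂ) *
      (𝓕 (toSchwartz u)) ((2 * Real.pi)⁻¹ • ξ) := by
  rw [fourierU, SchwartzMap.fourier_coe, Real.fourier_eq']
  congr 1
  apply integral_congr_ae
  refine Eventually.of_forall fun x => ?_
  have : (toSchwartz u) x = (u : Rn n → ℂ) x := rfl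
  simp only [this, smul_eq_mul]
  rw [mul_comm]
  congr 2
  rw [inner_smul_right, real_inner_comm]
  have : (Real.pi : ℂ) ≠ 0 := by exact_mod_cast Real.pi_ne_zero
  push_cast
  field_simp

lemma continuous_fourierU {n : ℕ} (u : radialTest n) :
    Continuous (fourierU (u : Rn n → ℂ)) := by
  rw [funext (fourierU_eq u)]
  exact continuous_const.mul ((𝓕 (toSchwartz u)).continuous.comp (continuous_const_smul _))

lemma rpow_le_pow_ceil {s t : ℝ} (hs : 0 ≤ s) (ht : 0 ≤ t) : t ^ s ≤ 1 + t ^ ⌈s⌉₊ := by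
  rcases le_total t 1 with h | h
  · have := Real.rpow_le_one ht h hs
    have := pow_nonneg ht ⌈s⌉₊
    linarith
  · have := Real.rpow_le_rpow_of_exponent_le h (Nat.le_ceil s)
    rw [Real.rpow_natCast] at this
    linarith

lemma continuous_weight {n : ℕ} {s : ℝ} (hs : 0 ≤ s) (u : radialTest n) :
    Continuous fun ξ : Rn n => ((‖ξ‖ ^ s : ℝ) : ℂ) * fourierU (u : Rn n → ℂ) ξ :=
  (Complex.continuous_ofReal.comp (continuous_norm.rpow_const fun _ => Or.inr hs)).mul
    (continuous_fourierU u)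

lemma exists_bound {n : ℕ} {s : ℝ} (hs : 0 ≤ s) (u : radialTest n) :
    ∃ G : Rn n → ℝ, Integrable G ∧ (∃ C, ∀ ξ, G ξ ≤ C) ∧
      ∀ ξ, ‖((‖ξ‖ ^ s : ℝ) : ℂ) * fourierU (u : Rn n → ℂ) ξ‖ ≤ G ξ := by
  set c : ℝ := (2 * Real.pi) ^ (-(n : ℝ) / 2) with hc
  have hc0 : 0 ≤ c := by positivity
  set g := 𝓕 (toSchwartz u) with hg
  set k := ⌈s⌉₊
  let H : Rn n → ℝ := fun η => c * (‖g η‖ + (2 * Real.pi) ^ k * (‖η‖ ^ k * ‖g η‖))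
  have hH : Integrable H := by
    refine Integrable.const_mul ?_ c
    exact g.integrable.norm.add ((g.integrable_pow_mul volume k).const_mul _)
  have hpi : (2 * Real.pi) ≠ 0 := by positivity
  refine ⟨fun ξ => H ((2 * Real.pi)⁻¹ • ξ), ?_, ?_, ?_⟩
  · exact hH.comp_smul (inv_ne_zero hpi)
  · obtain ⟨C₀, -, h₀⟩ := g.decay 0 0
    obtain ⟨C₁, -, h₁⟩ := g.decay k 0
    refine ⟨c * (C₀ + (2 * Real.pi) ^ k * C₁), fun ξ => ?_⟩
    have h₀' := h₀ ((2 * Real.pi)⁻¹ • ξ)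
    have h₁' := h₁ ((2 * Real.pi)⁻¹ • ξ)
    simp only [pow_zero, one_mul, norm_iteratedFDeriv_zero] at h₀' h₁'
    simp only [H]
    gcongr
  · intro ξ
    rw [fourierU_eq, norm_mul, norm_mul]
    have e1 : ‖((‖ξ‖ ^ s : ℝ) : ℂ)‖ = ‖ξ‖ ^ s := by
      rw [Complex.norm_real, Real.norm_of_nonneg (by positivity)]
    have e2 : ‖((c : ℝ) : ℂ)‖ = c := by
      rw [Complex.norm_real, Real.norm_of_nonneg hc0]
    rw [e1, e2]
    have e3 : (2 * Real.pi) ^ k * ‖(2 * Real.pi)⁻¹ • ξ‖ ^ k = ‖ξ‖ ^ k := by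
      rw [← mul_pow, norm_smul, Real.norm_of_nonneg (by positivity), mul_inv_cancel_left₀ hpi]
    have := rpow_le_pow_ceil hs (norm_nonneg ξ)
    simp only [H]
    rw [← mul_assoc ((2 * Real.pi) ^ k), e3]
    calc ‖ξ‖ ^ s * (c * ‖g ((2 * Real.pi)⁻¹ • ξ)‖)
        ≤ (1 + ‖ξ‖ ^ k) * (c * ‖g ((2 * Real.pi)⁻¹ • ξ)‖) := by gcongr
      _ = _ := by ring

lemma integrable_homInner {n : ℕ} {s : ℝ} (hs : 0 ≤ s) (u v : radialTest n) :
    Integrable fun ξ : Rn n => conj (((‖ξ‖ ^ s : ℝ) : ℂ) * fourierU (u : Rn n → ℂ) ξ) *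
      (((‖ξ‖ ^ s : ℝ) : ℂ) * fourierU (v : Rn n → ℂ) ξ) := by
  obtain ⟨G, -, ⟨C, hC⟩, hG⟩ := exists_bound hs u
  obtain ⟨G', hG'i, -, hG'⟩ := exists_bound hs v
  refine (hG'i.const_mul C).mono'
    ((Complex.continuous_conj.comp (continuous_weight hs u)).mul
      (continuous_weight hs v)).aestronglyMeasurable (Eventually.of_forall fun ξ => ?_)
  rw [norm_mul, RCLike.norm_conj]
  exact mul_le_mul ((hG ξ).trans (hC ξ)) (hG' ξ) (norm_nonneg _)
    ((norm_nonneg _).trans ((hG ξ).trans (hC ξ)))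

lemma fourierU_add {n : ℕ} (u v : radialTest n) (ξ : Rn n) :
    fourierU ((u + v : radialTest n) : Rn n → ℂ) ξ
      = fourierU (u : Rn n → ℂ) ξ + fourierU (v : Rn n → ℂ) ξ := by
  have : toSchwartz (u + v) = toSchwartz u + toSchwartz v := rfl
  rw [fourierU_eq, fourierU_eq, fourierU_eq, this, FourierTransform.fourier_add,
    _root_.add_apply, mul_add]

lemma fourierU_smul {n : ℕ} (c : ℂ) (u : radialTest n) (ξ : Rn n) :
    fourierU ((c • u : radialTest n) : Rn n → ℂ) ξ = c * fourierU (u : Rn n → ℂ) ξ := by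
  have : toSchwartz (c • u) = c • toSchwartz u := rfl
  rw [fourierU_eq, fourierU_eq, this, FourierTransform.fourier_smul, _root_.smul_apply,
    smul_eq_mul]
  ring

lemma homInner_add_left {n : ℕ} {s : ℝ} (hs : 0 ≤ s) (u v w : radialTest n) :
    homInner s ((u + v : radialTest n) : Rn n → ℂ) (w : Rn n → ℂ)
      = homInner s (u : Rn n → ℂ) w + homInner s (v : Rn n → ℂ) w := by
  unfold homInner
  rw [← integral_add (integrable_homInner hs u w) (integrable_homInner hs v w)]
  refine integral_congr_ae (Eventually.of_forall fun ξ => ?_)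
  simp only [fourierU_add, map_mul, map_add]
  ring

lemma homInner_smul_left {n : ℕ} (s : ℝ) (c : ℂ) (u w : radialTest n) :
    homInner s ((c • u : radialTest n) : Rn n → ℂ) (w : Rn n → ℂ)
      = conj c * homInner s (u : Rn n → ℂ) w := by
  unfold homInner
  rw [← integral_const_mul]
  refine integral_congr_ae (Eventually.of_forall fun ξ => ?_)
  simp only [fourierU_smul, map_mul]
  ring

lemma homInner_conj_symm {n : ℕ} (s : ℝ) (u v : Rn n → ℂ) :
    conj (homInner s v u) = homInner s u v := by
  unfold homInner
  rw [← integral_conj]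
  refine integral_congr_ae (Eventually.of_forall fun ξ => ?_)
  simp only [map_mul, Complex.conj_conj]
  ring

lemma homInner_self {n : ℕ} (s : ℝ) (u : Rn n → ℂ) :
    homInner s u u =
      ((∫ ξ : Rn n, ‖((‖ξ‖ ^ s : ℝ) : ℂ) * fourierU u ξ‖ ^ 2 : ℝ) : ℂ) := by
  unfold homInner
  rw [← integral_complex_ofReal]
  refine integral_congr_ae (Eventually.of_forall fun ξ => ?_)
  simp only
  rw [Complex.conj_mul']
  push_cast
  rfl

lemma homInner_self_nonneg {n : ℕ} (s : ℝ) (u : Rn n → ℂ) : 0 ≤ (homInner s u u).re := by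
  rw [homInner_self, Complex.ofReal_re]
  exact integral_nonneg fun _ => by positivity

lemma homInner_definite {n : ℕ} (hn : 1 ≤ n) {s : ℝ} (hs : 0 ≤ s) (u : radialTest n)
    (h : (homInner s (u : Rn n → ℂ) u).re = 0) : u = 0 := by
  have : Nonempty (Fin n) := ⟨⟨0, hn⟩⟩
  rw [homInner_self, Complex.ofReal_re] at h
  have hint : Integrable fun ξ : Rn n =>
      ‖((‖ξ‖ ^ s : ℝ) : ℂ) * fourierU (u : Rn n → ℂ) ξ‖ ^ 2 := by
    refine (integrable_homInner hs u u).norm.congr (Eventually.of_forall fun ξ => ?_)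
    simp only
    rw [norm_mul, RCLike.norm_conj, sq]
  have hcont : Continuous fun ξ : Rn n =>
      ‖((‖ξ‖ ^ s : ℝ) : ℂ) * fourierU (u : Rn n → ℂ) ξ‖ ^ 2 := (continuous_weight hs u).norm.pow 2
  rw [integral_eq_zero_iff_of_nonneg (fun _ => by positivity) hint] at h
  have h' := (hcont.ae_eq_iff_eq volume continuous_const).1 h
  have h0 : ∀ ξ : Rn n, ξ ≠ 0 → fourierU (u : Rn n → ℂ) ξ = 0 := by
    intro ξ hξ
    have hξ' : ‖((‖ξ‖ ^ s : ℝ) : ℂ) * fourierU (u : Rn n → ℂ) ξ‖ ^ 2 = 0 := congrFun h' ξ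
    rw [sq_eq_zero_iff, norm_eq_zero, mul_eq_zero, Complex.ofReal_eq_zero] at hξ'
    rcases hξ' with h | h
    · exact absurd h (Real.rpow_pos_of_pos (norm_pos_iff.2 hξ) s).ne'
    · exact h
  have h1 : fourierU (u : Rn n → ℂ) = fun _ => 0 := by
    refine Continuous.ext_on (dense_compl_singleton (0 : Rn n)) (continuous_fourierU u)
      continuous_const fun ξ hξ => h0 ξ hξ
  have h2 : 𝓕 (toSchwartz u) = 0 := by
    ext η
    have := congrFun h1 ((2 * Real.pi) • η)
    rw [fourierU_eq, inv_smul_smul₀ (by positivity)] at this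
    simpa using (mul_eq_zero.1 this).resolve_left
      (Complex.ofReal_ne_zero.2 (Real.rpow_pos_of_pos (by positivity) _).ne')
  have h3 : toSchwartz u = 0 := by
    have := FourierTransform.fourierInv_fourier_eq (F := SchwartzMap (Rn n) ℂ) (toSchwartz u)
    rw [← this, h2, FourierTransform.fourierInv_zero]
  ext x
  exact DFunLike.congr_fun h3 x

lemma interInner_add_left {n : ℕ} {s₁ s₂ : ℝ} (h₁ : 0 ≤ s₁) (h : s₁ ≤ s₂)
    (u v w : radialTest n) :
    interInner s₁ s₂ ((u + v : radialTest n) : Rn n → ℂ) (w : Rn n → ℂ)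
      = interInner s₁ s₂ (u : Rn n → ℂ) w + interInner s₁ s₂ (v : Rn n → ℂ) w := by
  unfold interInner
  rw [homInner_add_left h₁, homInner_add_left (h₁.trans h)]
  split_ifs <;> ring

lemma interInner_smul_left {n : ℕ} (s₁ s₂ : ℝ) (c : ℂ) (u w : radialTest n) :
    interInner s₁ s₂ ((c • u : radialTest n) : Rn n → ℂ) (w : Rn n → ℂ)
      = conj c * interInner s₁ s₂ (u : Rn n → ℂ) w := by
  unfold interInner
  rw [homInner_smul_left, homInner_smul_left]
  split_ifs <;> ring

lemma interInner_conj_symm {n : ℕ} (s₁ s₂ : ℝ) (u v : Rn n → ℂ) :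
    conj (interInner s₁ s₂ v u) = interInner s₁ s₂ u v := by
  unfold interInner
  split_ifs <;> simp [homInner_conj_symm]

lemma homInner_le_interInner {n : ℕ} (s₁ s₂ : ℝ) (u : Rn n → ℂ) :
    (homInner s₁ u u).re ≤ (interInner s₁ s₂ u u).re := by
  unfold interInner
  have := homInner_self_nonneg s₂ u
  split_ifs <;> simp [this]

/-! ### The intersection space -/

/-- Standing conditions `n ≥ 1` and `1 ≤ s₁ ≤ s₂`, under which `ℋ^{s₁,s₂}` is defined. -/
structure Exponents (n : ℕ) (s₁ s₂ : ℝ) : Prop where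
  one_le_dim : 1 ≤ n
  one_le : 1 ≤ s₁
  le : s₁ ≤ s₂

lemma Exponents.of_lt {n : ℕ} {s₁ s₂ : ℝ} (hn : 3 ≤ n) (h₁ : 1 < s₁) (h₁₂ : s₁ ≤ s₂) :
    Exponents n s₁ s₂ :=
  ⟨le_trans (by norm_num) hn, h₁.le, h₁₂⟩

variable {n : ℕ} {s₁ s₂ : ℝ}

/-- The test space `C^∞_{c,r}(ℝⁿ) × C^∞_{c,r}(ℝⁿ)`, which carries the inner product of
`ℋ^{s₁,s₂}` (and not the product norm). -/
def TestPair (_h : Exponents n s₁ s₂) : Type := radialTest n × radialTest n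

instance (h : Exponents n s₁ s₂) : AddCommGroup (TestPair h) :=
  inferInstanceAs (AddCommGroup (radialTest n × radialTest n))

instance (h : Exponents n s₁ s₂) : Module ℂ (TestPair h) :=
  inferInstanceAs (Module ℂ (radialTest n × radialTest n))

/-- The inner product
`⟨u,v⟩ = ⟨u₁,v₁⟩_{Ḣ^{s₁} ∩ Ḣ^{s₂}} + ⟨u₂,v₂⟩_{Ḣ^{s₁-1} ∩ Ḣ^{s₂-1}}`. -/
abbrev testPairCore (h : Exponents n s₁ s₂) : InnerProductSpace.Core ℂ (TestPair h) where
  inner u v := interInner s₁ s₂ (u.1 : Rn n → ℂ) v.1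
    + interInner (s₁ - 1) (s₂ - 1) (u.2 : Rn n → ℂ) v.2
  conj_inner_symm u v := by
    simp only [map_add, interInner_conj_symm]
  re_inner_nonneg u := by
    have a := (homInner_self_nonneg s₁ (u.1 : Rn n → ℂ)).trans (homInner_le_interInner s₁ s₂ _)
    have b := (homInner_self_nonneg (s₁ - 1) (u.2 : Rn n → ℂ)).trans
      (homInner_le_interInner (s₁ - 1) (s₂ - 1) _)
    exact add_nonneg a b
  add_left u v w := by
    have h0 := h.one_le
    have h2 := h.le
    change interInner s₁ s₂ ((u.1 + v.1 : radialTest n) : Rn n → ℂ) w.1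
      + interInner (s₁ - 1) (s₂ - 1) ((u.2 + v.2 : radialTest n) : Rn n → ℂ) w.2 = _
    rw [interInner_add_left (by linarith) h2, interInner_add_left (by linarith) (by linarith)]
    ring
  smul_left u v c := by
    change interInner s₁ s₂ ((c • u.1 : radialTest n) : Rn n → ℂ) v.1
      + interInner (s₁ - 1) (s₂ - 1) ((c • u.2 : radialTest n) : Rn n → ℂ) v.2 = _
    rw [interInner_smul_left, interInner_smul_left]
    ring
  definite u hu := by
    have h0 := h.one_le
    have a := homInner_self_nonneg s₁ (u.1 : Rn n → ℂ)
    have b := homInner_self_nonneg (s₁ - 1) (u.2 : Rn n → ℂ)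
    have a' := homInner_le_interInner s₁ s₂ (u.1 : Rn n → ℂ)
    have b' := homInner_le_interInner (s₁ - 1) (s₂ - 1) (u.2 : Rn n → ℂ)
    have hu' := congrArg Complex.re hu
    rw [Complex.add_re, Complex.zero_re] at hu'
    exact Prod.ext
      (homInner_definite h.one_le_dim (s := s₁) (by linarith) u.1 (by linarith))
      (homInner_definite h.one_le_dim (s := s₁ - 1) (by linarith) u.2 (by linarith))

instance (h : Exponents n s₁ s₂) : NormedAddCommGroup (TestPair h) :=
  (testPairCore h).toNormedAddCommGroup

instance (h : Exponents n s₁ s₂) : InnerProductSpace ℂ (TestPair h) :=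
  InnerProductSpace.ofCore (testPairCore h).toCore

/-- The Hilbert space `ℋ^{s₁,s₂}`: the completion of the radial test space. -/
abbrev HSpace (h : Exponents n s₁ s₂) : Type := UniformSpace.Completion (TestPair h)

/-- The inclusion of the test space in `ℋ^{s₁,s₂}`. -/
def incl (h : Exponents n s₁ s₂) : TestPair h →ₗ[ℂ] HSpace h :=
  (UniformSpace.Completion.toComplₗᵢ : TestPair h →ₗᵢ[ℂ] HSpace h).toLinearMap

lemma incl_injective (h : Exponents n s₁ s₂) : Function.Injective (incl h) :=
  (UniformSpace.Completion.toComplₗᵢ : TestPair h →ₗᵢ[ℂ] HSpace h).injective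

/-! ### The free wave operator in similarity variables -/

/-- The operator `Λf(x) = xⁱ ∂ᵢf(x)` on radial test functions. -/
def lam (n : ℕ) : radialTest n →ₗ[ℂ] radialTest n where
  toFun f := ⟨fun x => fderiv ℝ (f : Rn n → ℂ) x x, by
    obtain ⟨f, hf, hf', hf''⟩ := f
    refine ⟨(hf.fderiv_right (m := ∞) (by simp)).clm_apply contDiff_id, ?_, ?_⟩
    · refine (hf'.fderiv ℝ).mono fun x hx => ?_
      rw [Function.mem_support] at hx ⊢
      intro h
      exact hx (by simp [h])
    · intro x y hxy
      have key : ∀ z : Rn n, HasDerivAt (fun t : ℝ => f (t • z)) (fderiv ℝ f z z) 1 := by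
        intro z
        have h1 : HasFDerivAt f (fderiv ℝ f z) ((1 : ℝ) • z) := by
          rw [one_smul]
          exact (hf.differentiable (by simp) z).hasFDerivAt
        have h2 : HasDerivAt (fun t : ℝ => t • z) ((1 : ℝ) • z) 1 :=
          (hasDerivAt_id (1 : ℝ)).smul_const z
        have h3 := h1.comp_hasDerivAt (1 : ℝ) h2
        rw [one_smul] at h3
        exact h3
      have e : (fun t : ℝ => f (t • x)) = fun t : ℝ => f (t • y) := by
        funext t
        exact hf'' _ _ (by rw [norm_smul, norm_smul, hxy])
      have hx := key x
      rw [e] at hx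
      exact hx.unique (key y)⟩
  map_add' f g := by
    ext x
    have hf := (f.2.1.differentiable (by simp)) x
    have hg := (g.2.1.differentiable (by simp)) x
    simp [fderiv_add hf hg]
  map_smul' c f := by
    ext x
    have hf := (f.2.1.differentiable (by simp)) x
    simp [fderiv_const_smul hf c]

/-- The Laplacian on radial test functions. -/
def lap (n : ℕ) : radialTest n →ₗ[ℂ] radialTest n where
  toFun f := ⟨Laplacian.laplacian (f : Rn n → ℂ), by
    obtain ⟨f, hf, hf', hf''⟩ := f
    have hformula := InnerProductSpace.laplacian_eq_iteratedFDeriv_orthonormalBasis f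
      (EuclideanSpace.basisFun (Fin n) ℝ)
    refine ⟨?_, ?_, ?_⟩
    · rw [hformula]
      refine ContDiff.sum fun i _ => ?_
      exact (ContinuousMultilinearMap.apply ℝ (fun _ : Fin 2 => Rn n) ℂ _).contDiff.comp
        (hf.iteratedFDeriv_right (m := ∞) (i := 2) le_rfl)
    · refine (hf'.iteratedFDeriv (𝕜 := ℝ) 2).mono fun x hx => ?_
      rw [Function.mem_support] at hx ⊢
      intro h
      refine hx ?_
      rw [hformula]
      simp [h]
    · intro x y hxy
      let R : Rn n ≃ₗᵢ[ℝ] Rn n := (ℝ ∙ (x - y))ᗮ.reflection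
      have hR : R x = y := Submodule.reflection_sub hxy
      have hfR : f ∘ R = f := by
        funext z
        exact hf'' _ _ (R.norm_map z)
      have e := congrFun (InnerProductSpace.laplacian_eq_iteratedFDeriv_orthonormalBasis f
        ((EuclideanSpace.basisFun (Fin n) ℝ).map R)) y
      have e' := congrFun hformula x
      rw [e, e']
      refine Finset.sum_congr rfl fun i _ => ?_
      conv_lhs => rw [← hfR]
      have e2 := R.toContinuousLinearEquiv.toContinuousLinearMap.iteratedFDeriv_comp_right
        (f := f) hf x (i := 2) two_le_smooth
      have e3 : R.toContinuousLinearEquiv.toContinuousLinearMap x = y := hR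
      rw [e3] at e2
      have e4 := congrArg (fun T => T ![EuclideanSpace.basisFun (Fin n) ℝ i,
        EuclideanSpace.basisFun (Fin n) ℝ i]) e2
      refine e4.trans ?_
      rw [ContinuousMultilinearMap.compContinuousLinearMap_apply]
      congr 1
      ext j : 1
      fin_cases j <;> simp⟩
  map_add' f g := by
    ext x
    have hf : ContDiffAt ℝ 2 (f : Rn n → ℂ) x := (f.2.1.of_le two_le_smooth).contDiffAt
    have hg : ContDiffAt ℝ 2 (g : Rn n → ℂ) x := (g.2.1.of_le two_le_smooth).contDiffAt
    exact hf.laplacian_add hg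
  map_smul' c f := by
    ext x
    have hf : ContDiffAt ℝ 2 (f : Rn n → ℂ) x := (f.2.1.of_le two_le_smooth).contDiffAt
    exact InnerProductSpace.laplacian_smul c hf

/-- The action of
`L̃₀ (u₁, u₂) = (-Λu₁ - 2u₁ + u₂, Δu₁ - Λu₂ - 3u₂)` on the test space. -/
def freeWave (h : Exponents n s₁ s₂) : TestPair h →ₗ[ℂ] TestPair h where
  toFun u := (-lam n u.1 - (2 : ℂ) • u.1 + u.2, lap n u.1 - lam n u.2 - (3 : ℂ) • u.2)
  map_add' u v := by
    change (-lam n (u.1 + v.1) - (2 : ℂ) • (u.1 + v.1) + (u.2 + v.2),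
      lap n (u.1 + v.1) - lam n (u.2 + v.2) - (3 : ℂ) • (u.2 + v.2)) =
      ((-lam n u.1 - (2 : ℂ) • u.1 + u.2) + (-lam n v.1 - (2 : ℂ) • v.1 + v.2),
      (lap n u.1 - lam n u.2 - (3 : ℂ) • u.2) + (lap n v.1 - lam n v.2 - (3 : ℂ) • v.2))
    simp only [map_add, smul_add]
    ext1 <;> dsimp only <;> abel
  map_smul' c u := by
    change (-lam n (c • u.1) - (2 : ℂ) • (c • u.1) + c • u.2,
      lap n (c • u.1) - lam n (c • u.2) - (3 : ℂ) • (c • u.2)) =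
      (c • (-lam n u.1 - (2 : ℂ) • u.1 + u.2), c • (lap n u.1 - lam n u.2 - (3 : ℂ) • u.2))
    simp only [map_smul, smul_add, smul_sub, smul_neg, smul_comm c]

/-- The operator `L̃₀ : 𝒟(L̃₀) ⊆ ℋ^{s₁,s₂} → ℋ^{s₁,s₂}` with domain (the image in `ℋ^{s₁,s₂}` of)
`C^∞_{c,r}(ℝⁿ) × C^∞_{c,r}(ℝⁿ)`. -/
def freeOp (h : Exponents n s₁ s₂) : HSpace h →ₗ.[ℂ] HSpace h where
  domain := LinearMap.range (incl h)
  toFun := incl h ∘ₗ freeWave h ∘ₗ (LinearEquiv.ofInjective (incl h) (incl_injective h)).symm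

/-! ### Strongly continuous semigroups -/

/-- A strongly continuous one-parameter semigroup of bounded operators. -/
structure IsC0Semigroup {X : Type*} [NormedAddCommGroup X] [NormedSpace ℂ X]
    (S : ℝ≥0 → X →L[ℂ] X) : Prop where
  map_zero : S 0 = ContinuousLinearMap.id ℂ X
  map_add : ∀ t r, S (t + r) = (S t).comp (S r)
  continuous : ∀ x, Continuous fun t => S t x

/-- `A` is the infinitesimal generator of `S`: `x ∈ 𝒟(A)` and `A x = y` if and only if
`(S(t)x - x)/t → y` as `t → 0⁺`. -/
def IsGenerator {X : Type*} [NormedAddCommGroup X] [NormedSpace ℂ X]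
    (A : X →ₗ.[ℂ] X) (S : ℝ≥0 → X →L[ℂ] X) : Prop :=
  ∀ x y : X, (x, y) ∈ A.graph ↔
    Tendsto (fun t : ℝ≥0 => ((t⁻¹ : ℝ≥0) : ℂ) • (S t x - x)) (𝓝[>] 0) (𝓝 y)

end SimilarityWave

end

/-! Write ρ = 2π|η| and let p, q be the Fourier transforms of u₁, u₂. The transform turns -Λ into n
+ η·∇ and Δ into -ρ². On the pair (ρp, q) the operator therefore acts as the scalar dilation
generator n - 3 + η·∇ plus the rotation (ρp, q) ↦ (ρq, -ρ·ρp). Since η·∇ρ = ρ, the phases e^{∓iρ}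
absorb this rotation: the half-wave amplitudes e^{∓iρ}(ρp ± iq)/√2 of L̃₀u are (n - 3) + η·∇ applied
to those of u (`halfWave_waveSchwartz`). By the parallelogram law the amplitudes also carry the norm
of ℋ isometrically into L² with weight w = ρ^{2(s₁-1)} + ρ^{2(s₂-1)}, the second term only if s₁ <
s₂ (`norm_halfWaveLp_pairSchwartz`).

The semigroup is thus explicit: b ↦ e^{(n-3)τ} b(e^τ ·). A change of variables produces the factor
e^{2(n-3)τ - nτ} in the squared norm, and w(e^{-τ}ζ) ≤ e^{-2(s₁-1)τ} w(ζ) because s₁ ≤ s₂. Together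
they give the rate n/2 - 2 - s₁ (`norm_annularToLp_dilate_le`).

Smooth radial amplitudes supported in annuli avoid the singularity of ρ at the origin, are preserved
by dilations, and correspond to a dense subspace of ℋ. Such an invariant dense space is a core: the
generator of the extended semigroup is the closure of its derivative there
(`exists_semigroup_of_core`).

It remains to see that test functions and annular amplitudes give the same closed graph
(`topologicalClosure_graph_freeOp`). In one direction the amplitude of a test pair is cut off to
growing annuli; the commutator with η·∇ stays bounded by scale invariance and tends to 0 pointwise.
In the other, an annular amplitude is inverted to a radial Schwartz pair, which is then truncated in
space. Closability follows because the common closure is the graph of a generator, hence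
single-valued. -/

noncomputable section

namespace SimilarityWave

/-! ### Semigroups and generators from an invariant dense core -/

section Semigroup

variable {X G : Type*} [NormedAddCommGroup X] [NormedSpace ℂ X] [AddCommGroup G] [Module ℂ G]

lemma tendsto_nnreal_nhds_zero {Y : Type*} [TopologicalSpace Y] {f : ℝ≥0 → Y} {x : Y} (h0 : f 0 = x)
    (h : Tendsto f (𝓝[>] 0) (𝓝 x)) : Tendsto f (𝓝 0) (𝓝 x) := by
  have e : 𝓝 (0 : ℝ≥0) = pure 0 ⊔ 𝓝[>] 0 := by
    rw [← pure_sup_nhdsNE (0 : ℝ≥0)]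
    congr 2
    ext t
    simp [pos_iff_ne_zero]
  rw [e]
  exact tendsto_sup.2 ⟨by rw [tendsto_pure_left]; intro s hs; rw [h0]; exact mem_of_mem_nhds hs, h⟩

/-- Replacing κ by |κ| makes the bound monotone in time, hence uniform on [0, r] for either sign of
κ. -/
lemma norm_apply_le_exp {S : ℝ≥0 → X →L[ℂ] X} {κ : ℝ}
    (hb : ∀ t x, ‖S t x‖ ≤ Real.exp (κ * t) * ‖x‖) {t r : ℝ≥0} (htr : t ≤ r) (x : X) :
    ‖S t x‖ ≤ Real.exp (|κ| * r) * ‖x‖ := by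
  refine (hb t x).trans ?_
  gcongr
  exact le_abs_self κ

/-- Strong right-continuity at `0` on a dense set gives strong right-continuity at `0`. -/
lemma tendsto_zero_of_dense {S : ℝ≥0 → X →L[ℂ] X} {κ : ℝ}
    (hb : ∀ t x, ‖S t x‖ ≤ Real.exp (κ * t) * ‖x‖) {D : Set X} (hD : Dense D)
    (h : ∀ x ∈ D, Tendsto (fun t => S t x) (𝓝 0) (𝓝 x)) (x : X) :
    Tendsto (fun t => S t x) (𝓝 0) (𝓝 x) := by
  rw [Metric.tendsto_nhds]
  intro ε hε
  set M := Real.exp (|κ| * (1 : ℝ≥0))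
  have hM : 0 < M := Real.exp_pos _
  obtain ⟨z, hz, hxz⟩ := hD.exists_dist_lt x (ε := ε / (2 * (M + 1))) (by positivity)
  filter_upwards [Metric.tendsto_nhds.1 (h z hz) (ε / 2) (by positivity),
    Iic_mem_nhds (show (0 : ℝ≥0) < 1 by norm_num)] with t ht ht1
  have e1 : dist (S t x) (S t z) ≤ M * dist x z := by
    rw [dist_eq_norm, dist_eq_norm, ← map_sub]
    exact norm_apply_le_exp hb ht1 _
  have e2 : (M + 1) * dist x z < ε / 2 := by
    rw [lt_div_iff₀ (by positivity)] at hxz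
    linarith
  calc dist (S t x) x ≤ dist (S t x) (S t z) + dist (S t z) z + dist z x := dist_triangle4 _ _ _ _
    _ < ε := by rw [dist_comm z x]; linarith

/-- For p ≤ q, S(q) - S(p) = S(p)(S(q - p) - 1) with S(p) locally bounded, so continuity from either
side at t reduces to continuity at 0. -/
lemma continuous_of_tendsto_zero {S : ℝ≥0 → X →L[ℂ] X} {κ : ℝ}
    (hb : ∀ t x, ‖S t x‖ ≤ Real.exp (κ * t) * ‖x‖) (hadd : ∀ t r, S (t + r) = (S t).comp (S r))
    (h : ∀ x, Tendsto (fun t => S t x) (𝓝 0) (𝓝 x)) (x : X) : Continuous fun t => S t x := by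
  rw [continuous_iff_continuousAt]
  intro t
  have key : ∀ p q : ℝ≥0, p ≤ q → q ≤ t + 1 →
      dist (S p x) (S q x) ≤ Real.exp (|κ| * (t + 1 : ℝ≥0)) * dist (S (nndist p q) x) x := by
    intro p q hpq hq
    have : q = p + nndist p q := by
      rw [NNReal.nndist_eq, tsub_eq_zero_of_le hpq, max_eq_right zero_le, add_tsub_cancel_of_le hpq]
    have e : S q x = S p (S (nndist p q) x) := by
      conv_lhs => rw [this, hadd]
      rfl
    rw [e, dist_comm, dist_eq_norm, dist_eq_norm, ← map_sub]
    exact norm_apply_le_exp hb (hpq.trans hq) _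
  have hlim : Tendsto (fun r => Real.exp (|κ| * (t + 1 : ℝ≥0)) * dist (S (nndist r t) x) x)
      (𝓝 t) (𝓝 0) := by
    have h1 : Tendsto (fun r => nndist r t) (𝓝 t) (𝓝 0) := by
      have : Continuous fun r : ℝ≥0 => nndist r t := by fun_prop
      simpa using this.tendsto t
    have h2 := ((h x).comp h1).dist (tendsto_const_nhds (x := x))
    rw [dist_self] at h2
    simpa using h2.const_mul (Real.exp (|κ| * (t + 1 : ℝ≥0)))
  refine tendsto_iff_dist_tendsto_zero.2 (squeeze_zero' (Eventually.of_forall fun _ => dist_nonneg)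
    ?_ hlim)
  filter_upwards [Iic_mem_nhds (show t < t + 1 from lt_add_of_pos_right t one_pos)] with r hr
  rcases le_total r t with hrt | hrt
  · exact key r t hrt (by simp)
  · rw [dist_comm, nndist_comm]
    exact key t r hrt hr

/-- The integral `∫₀ᵗ S(s) x ds` of an orbit. -/
def orbitIntegral (S : ℝ≥0 → X →L[ℂ] X) (t : ℝ) (x : X) : X := ∫ s in (0 : ℝ)..t, S s.toNNReal x

lemma IsC0Semigroup.continuous_real {S : ℝ≥0 → X →L[ℂ] X} (hS : IsC0Semigroup S) (x : X) :
    Continuous fun s : ℝ => S s.toNNReal x :=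
  (hS.continuous x).comp continuous_real_toNNReal

/-- Continuity in x lets integral identities proved on the core pass to closures. -/
lemma continuous_orbitIntegral {S : ℝ≥0 → X →L[ℂ] X} (hS : IsC0Semigroup S) {κ : ℝ}
    (hb : ∀ t x, ‖S t x‖ ≤ Real.exp (κ * t) * ‖x‖) {t : ℝ} (ht : 0 ≤ t) :
    Continuous (orbitIntegral S t) := by
  refine (LipschitzWith.of_dist_le_mul (K := (Real.exp (|κ| * t) * t).toNNReal)
    fun x y => ?_).continuous
  rw [dist_eq_norm, orbitIntegral, orbitIntegral, ← intervalIntegral.integral_sub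
    ((hS.continuous_real x).intervalIntegrable _ _) ((hS.continuous_real y).intervalIntegrable _ _)]
  have := intervalIntegral.norm_integral_le_of_norm_le_const (a := 0) (b := t)
    (f := fun s : ℝ => S s.toNNReal x - S s.toNNReal y) (C := Real.exp (|κ| * t) * ‖x - y‖) ?_
  · rw [sub_zero, abs_of_nonneg ht] at this
    rw [Real.coe_toNNReal _ (by positivity), dist_eq_norm]
    linarith
  · intro s hs
    rw [Set.uIoc_of_le ht] at hs
    rw [← map_sub]
    have := norm_apply_le_exp hb (Real.toNNReal_le_toNNReal hs.2) (x - y)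
    rwa [Real.coe_toNNReal _ ht] at this

lemma tendsto_orbitIntegral [CompleteSpace X] {S : ℝ≥0 → X →L[ℂ] X} (hS : IsC0Semigroup S) (x : X) :
    Tendsto (fun t : ℝ≥0 => ((t⁻¹ : ℝ≥0) : ℂ) • orbitIntegral S t x) (𝓝[>] 0) (𝓝 x) := by
  have hc := hS.continuous_real x
  have h := intervalIntegral.integral_hasDerivAt_right (a := 0) (b := 0)
    (f := fun s : ℝ => S s.toNNReal x) (hc.intervalIntegrable _ _)
    hc.aestronglyMeasurable.stronglyMeasurableAtFilter hc.continuousAt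
  simp only [Real.toNNReal_zero, hS.map_zero] at h
  have h2 := h.tendsto_slope_zero_right
  have h3 : Tendsto (fun t : ℝ≥0 => (t : ℝ)) (𝓝[>] 0) (𝓝[>] 0) := by
    refine tendsto_nhdsWithin_iff.2 ⟨?_, ?_⟩
    · exact (NNReal.continuous_coe.tendsto' 0 0 rfl).mono_left nhdsWithin_le_nhds
    · filter_upwards [self_mem_nhdsWithin] with t ht
      simpa using ht
  refine (h2.comp h3).congr fun t => ?_
  simp only [Function.comp, zero_add, intervalIntegral.integral_same, sub_zero, orbitIntegral]
  rw [NNReal.coe_inv, ← Complex.coe_smul]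

variable [CompleteSpace X]

/-- If `S(t)x` has right derivative `S(t)y` at `t = 0`, then `S(t)x - x = ∫₀ᵗ S(s)y ds`. -/
lemma sub_eq_orbitIntegral {S : ℝ≥0 → X →L[ℂ] X} (hS : IsC0Semigroup S) {x y : X}
    (h : Tendsto (fun t : ℝ≥0 => ((t⁻¹ : ℝ≥0) : ℂ) • (S t x - x)) (𝓝[>] 0) (𝓝 y)) (t : ℝ≥0) :
    S t x - x = orbitIntegral S t y := by
  -- The hypothesis is one-sided and moves to a later time s through S(s + r)x - S(s)x = S(s)(S(r)x
  -- - x), which controls right derivatives only; this form of the fundamental theorem needs no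
  -- more.
  have := intervalIntegral.integral_eq_sub_of_hasDeriv_right_of_le (a := 0) (b := (t : ℝ))
    (f := fun s : ℝ => S s.toNNReal x) (f' := fun s : ℝ => S s.toNNReal y) t.coe_nonneg
    (hS.continuous_real x).continuousOn ?_ ((hS.continuous_real y).intervalIntegrable _ _)
  · simp only [Real.toNNReal_coe, Real.toNNReal_zero, hS.map_zero] at this
    exact this.symm
  · intro s hs
    rw [hasDerivWithinAt_iff_tendsto_slope' (by simp)]
    have h1 := ((S s.toNNReal).continuous.tendsto y).comp h
    have h2 : Tendsto (fun r : ℝ => (r - s).toNNReal) (𝓝[>] s) (𝓝[>] 0) := by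
      refine tendsto_nhdsWithin_iff.2 ⟨?_, ?_⟩
      · have : Continuous fun r : ℝ => (r - s).toNNReal := by fun_prop
        exact (this.tendsto' s 0 (by simp)).mono_left nhdsWithin_le_nhds
      · filter_upwards [self_mem_nhdsWithin] with r hr
        simpa using hr
    refine (h1.comp h2).congr' ?_
    filter_upwards [self_mem_nhdsWithin] with r hr
    have hr' : 0 ≤ r - s := (sub_pos.2 hr).le
    have e : r.toNNReal = s.toNNReal + (r - s).toNNReal := by
      rw [← Real.toNNReal_add hs.1.le hr']
      congr 1
      ring
    simp only [Function.comp, slope, vsub_eq_sub]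
    rw [e, hS.map_add, map_smul, map_sub, NNReal.coe_inv, Real.coe_toNNReal _ hr',
      Complex.coe_smul]
    rfl

/-- A densely defined family of operators, exponentially bounded, with the semigroup property and
differentiable at `0`, extends to a strongly continuous semigroup; the generator is the closure of
the derivative at `0`. -/
theorem exists_semigroup_of_core (j : G →ₗ[ℂ] X) (hj : DenseRange j) (T : ℝ≥0 → G →ₗ[ℂ] G)
    (A : G →ₗ[ℂ] G) (κ : ℝ) (h0 : ∀ g, T 0 g = g) (hadd : ∀ t r g, T (t + r) g = T t (T r g))
    (hb : ∀ t g, ‖j (T t g)‖ ≤ Real.exp (κ * t) * ‖j g‖)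
    (hder : ∀ g, Tendsto (fun t : ℝ≥0 => ((t⁻¹ : ℝ≥0) : ℂ) • (j (T t g) - j g)) (𝓝[>] 0)
      (𝓝 (j (A g)))) :
    ∃ S : ℝ≥0 → X →L[ℂ] X, IsC0Semigroup S ∧ (∀ t x, ‖S t x‖ ≤ Real.exp (κ * t) * ‖x‖) ∧
      ∀ x y, (x, y) ∈ (LinearMap.range (j.prod (j ∘ₗ A))).topologicalClosure ↔
        Tendsto (fun t : ℝ≥0 => ((t⁻¹ : ℝ≥0) : ℂ) • (S t x - x)) (𝓝[>] 0) (𝓝 y) := by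
  let S : ℝ≥0 → X →L[ℂ] X := fun t => (j ∘ₗ T t).extendOfNorm j
  have hSj : ∀ t g, S t (j g) = j (T t g) := fun t g =>
    LinearMap.extendOfNorm_eq hj ⟨_, hb t⟩ g
  have hSb : ∀ t x, ‖S t x‖ ≤ Real.exp (κ * t) * ‖x‖ := fun t x =>
    LinearMap.norm_extendOfNorm_apply_le hj _ (hb t) x
  have hSadd : ∀ t r, S (t + r) = (S t).comp (S r) := by
    intro t r
    refine ContinuousLinearMap.coeFn_injective (hj.equalizer (S (t + r)).continuous
      ((S t).comp (S r)).continuous ?_)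
    funext g
    simp [hSj, hadd]
  have hS0 : S 0 = ContinuousLinearMap.id ℂ X := by
    refine ContinuousLinearMap.coeFn_injective (hj.equalizer (S 0).continuous
      (ContinuousLinearMap.id ℂ X).continuous ?_)
    funext g
    simp [hSj, h0]
  have hder' : ∀ g, Tendsto (fun t : ℝ≥0 => ((t⁻¹ : ℝ≥0) : ℂ) • (S t (j g) - j g)) (𝓝[>] 0)
      (𝓝 (j (A g))) := by simpa only [hSj] using hder
  have hcont0 : ∀ x, Tendsto (fun t => S t x) (𝓝 0) (𝓝 x) := by
    refine tendsto_zero_of_dense hSb hj ?_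
    rintro _ ⟨g, rfl⟩
    refine tendsto_nnreal_nhds_zero (by simp [hS0]) ?_
    have h1 : Tendsto (fun t : ℝ≥0 => ((t : ℝ) : ℂ)) (𝓝[>] 0) (𝓝 0) := by
      have : Continuous fun t : ℝ≥0 => ((t : ℝ) : ℂ) := by fun_prop
      exact (this.tendsto' 0 0 (by simp)).mono_left nhdsWithin_le_nhds
    have h2 := (h1.smul (hder' g)).add_const (j g)
    rw [zero_smul, zero_add] at h2
    refine h2.congr' ?_
    filter_upwards [self_mem_nhdsWithin] with t ht
    have : ((t : ℝ) : ℂ) ≠ 0 := by simpa using ne_of_gt ht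
    rw [smul_smul, NNReal.coe_inv, Complex.ofReal_inv, mul_inv_cancel₀ this, one_smul,
      sub_add_cancel]
  have hS : IsC0Semigroup S := ⟨hS0, hSadd, continuous_of_tendsto_zero hSb hSadd hcont0⟩
  refine ⟨S, hS, hSb, fun x y => ?_⟩
  set Γ := (LinearMap.range (j.prod (j ∘ₗ A))).topologicalClosure with hΓ
  have hΓc : IsClosed (Γ : Set (X × X)) := Submodule.isClosed_topologicalClosure _
  have hmem : ∀ g, (j g, j (A g)) ∈ Γ := fun g =>
    Submodule.le_topologicalClosure _ ⟨g, rfl⟩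
  -- The derivative commutes with the flow: both sides are the limit of the same difference
  -- quotient, since T(t)T(r) = T(r)T(t).
  have hcomm : ∀ t g, S t (j (A g)) = j (A (T t g)) := by
    intro t g
    have h1 := ((S t).continuous.tendsto _).comp (hder' g)
    refine tendsto_nhds_unique (h1.congr fun r => ?_) (hder (T t g))
    simp only [Function.comp, map_smul, map_sub, hSj, ← hadd, add_comm]
  constructor
  · intro hxy
    -- This identity is a closed condition on (x, y) and holds on the core, so it holds on the
    -- closed graph; dividing by t and letting t → 0 gives the derivative.
    have key : ∀ t : ℝ≥0, S t x - x = orbitIntegral S t y := by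
      intro t
      have hcl : IsClosed {p : X × X | S t p.1 - p.1 = orbitIntegral S t p.2} :=
        isClosed_eq (by fun_prop) ((continuous_orbitIntegral hS hSb t.coe_nonneg).comp continuous_snd)
      refine closure_minimal (s := (LinearMap.range (j.prod (j ∘ₗ A)) : Set (X × X))) ?_ hcl hxy
      rintro _ ⟨g, rfl⟩
      exact sub_eq_orbitIntegral hS (hder' g) t
    simpa only [key] using tendsto_orbitIntegral hS y
  · intro hxy
    -- Conversely, time averages of orbits lie in Γ. By density and closedness it suffices to take z
    -- = j g, whose orbit s ↦ (S(s)z, S(s)j(Ag)) stays in Γ by invariance; Γ is closed and convex,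
    -- so it contains the average.
    have key : ∀ t : ℝ≥0, 0 < t → ∀ z, (orbitIntegral S t z, S t z - z) ∈ Γ := by
      intro t ht z
      have hcl : IsClosed {z | (orbitIntegral S t z, S t z - z) ∈ Γ} :=
        hΓc.preimage ((continuous_orbitIntegral hS hSb t.coe_nonneg).prodMk (by fun_prop))
      refine hj.induction_on z hcl fun g => ?_
      rw [sub_eq_orbitIntegral hS (hder' g) t]
      have hc1 := hS.continuous_real (j g)
      have hc2 := hS.continuous_real (j (A g))
      have hav := Convex.set_average_mem (μ := volume) (t := Set.Ioc (0 : ℝ) t)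
        (f := fun s : ℝ => (S s.toNNReal (j g), S s.toNNReal (j (A g))))
        (s := (Γ : Set (X × X))) (Γ.restrictScalars ℝ).convex hΓc
        (by simpa using ht.ne') (by simp) (Eventually.of_forall fun s => by
          simp only [hcomm]; rw [hSj]; exact hmem _)
        ((hc1.prodMk hc2).integrableOn_Ioc)
      rw [setAverage_eq] at hav
      have e : (t : ℂ) • ((volume.real (Set.Ioc (0 : ℝ) t))⁻¹ •
          ∫ s in Set.Ioc (0 : ℝ) t, (S s.toNNReal (j g), S s.toNNReal (j (A g)))) =
          (orbitIntegral S t (j g), orbitIntegral S t (j (A g))) := by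
        rw [integral_pair hc1.integrableOn_Ioc hc2.integrableOn_Ioc,
          Real.volume_real_Ioc_of_le t.coe_nonneg, sub_zero, orbitIntegral, orbitIntegral,
          intervalIntegral.integral_of_le t.coe_nonneg, intervalIntegral.integral_of_le t.coe_nonneg,
          ← Complex.coe_smul, smul_smul]
        have : ((t : ℝ) : ℂ) ≠ 0 := by simpa using ne_of_gt ht
        rw [Complex.ofReal_inv, mul_inv_cancel₀ this, one_smul]
      rw [← e]
      exact Γ.smul_mem _ hav
    -- The pairs (t⁻¹∫₀ᵗ S(s)x ds, t⁻¹(S(t)x - x)) lie in Γ and converge to (x, y).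
    have hlim := (tendsto_orbitIntegral hS x).prodMk_nhds hxy
    refine hΓc.mem_of_tendsto hlim ?_
    filter_upwards [self_mem_nhdsWithin] with t ht
    exact Γ.smul_mem _ (key t ht x)

end Semigroup

/-! ### Norms and dominated convergence in L² -/

section L2

variable {α E : Type*} [MeasurableSpace α] {μ : Measure α} [NormedAddCommGroup E]

lemma norm_toLp_two_sq [InnerProductSpace ℂ E] {f : α → E} (hf : MemLp f 2 μ) :
    ‖hf.toLp f‖ ^ 2 = ∫ x, ‖f x‖ ^ 2 ∂μ := by
  rw [← inner_self_eq_norm_sq (𝕜 := ℂ), L2.inner_def]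
  have : ∫ x, inner ℂ (hf.toLp f x) (hf.toLp f x) ∂μ = ∫ x, ((‖f x‖ ^ 2 : ℝ) : ℂ) ∂μ := by
    refine integral_congr_ae ?_
    filter_upwards [hf.coeFn_toLp] with x hx
    rw [hx, inner_self_eq_norm_sq_to_K]
    norm_cast
  rw [this, integral_complex_ofReal]
  simp

/-- Dominated convergence in `L²`. -/
lemma tendsto_toLp_two_of_dominated [InnerProductSpace ℂ E] {ι : Type*} {l : Filter ι}
    [l.IsCountablyGenerated] {F : ι → α → E} {f : α → E} (hF : ∀ i, MemLp (F i) 2 μ)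
    (hf : MemLp f 2 μ) {g : α → ℝ} (hg : MemLp g 2 μ)
    (hb : ∀ᶠ i in l, ∀ᵐ x ∂μ, ‖F i x - f x‖ ≤ g x)
    (hlim : ∀ᵐ x ∂μ, Tendsto (fun i => F i x) l (𝓝 (f x))) :
    Tendsto (fun i => (hF i).toLp (F i)) l (𝓝 (hf.toLp f)) := by
  rw [tendsto_iff_norm_sub_tendsto_zero]
  have h1 : ∀ i, ‖(hF i).toLp (F i) - hf.toLp f‖ ^ 2 = ∫ x, ‖F i x - f x‖ ^ 2 ∂μ := by
    intro i
    rw [← MemLp.toLp_sub, norm_toLp_two_sq]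
    rfl
  have h2 : Tendsto (fun i => ∫ x, ‖F i x - f x‖ ^ 2 ∂μ) l (𝓝 (∫ _, (0 : ℝ) ∂μ)) := by
    refine tendsto_integral_filter_of_dominated_convergence (fun x => g x ^ 2)
      (Eventually.of_forall fun i => (((hF i).sub hf).1.norm.pow 2)) ?_ hg.integrable_sq ?_
    · filter_upwards [hb] with i hi
      filter_upwards [hi] with x hx
      rw [Real.norm_of_nonneg (by positivity)]
      gcongr
    · filter_upwards [hlim] with x hx
      have := (tendsto_iff_norm_sub_tendsto_zero.1 hx).pow 2
      simpa using this
  rw [integral_zero] at h2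
  have h3 := (h2.congr fun i => (h1 i).symm).sqrt
  simpa using h3

end L2

/-! ### The weighted measure on frequency space -/

section Weight

variable {n : ℕ} {s₁ s₂ : ℝ}

/-- The angular frequency `2π‖η‖`. -/
def angFreq (η : Rn n) : ℝ := 2 * Real.pi * ‖η‖

lemma angFreq_nonneg (η : Rn n) : 0 ≤ angFreq η := by unfold angFreq; positivity

lemma angFreq_pos {η : Rn n} (hη : η ≠ 0) : 0 < angFreq η := by
  have := norm_pos_iff.2 hη
  unfold angFreq; positivity

lemma angFreq_smul {c : ℝ} (hc : 0 ≤ c) (η : Rn n) : angFreq (c • η) = c * angFreq η := by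
  rw [angFreq, norm_smul, Real.norm_of_nonneg hc, angFreq]
  ring

lemma continuous_angFreq : Continuous (angFreq : Rn n → ℝ) := by unfold angFreq; fun_prop

open Classical in
/-- The weight `ρ^{2(s₁-1)} + ρ^{2(s₂-1)}` (the second term only if `s₁ < s₂`), `ρ = 2π‖η‖`. -/
def freqWeight (s₁ s₂ : ℝ) (η : Rn n) : ℝ :=
  angFreq η ^ (2 * (s₁ - 1)) + if s₁ < s₂ then angFreq η ^ (2 * (s₂ - 1)) else 0

lemma freqWeight_nonneg (η : Rn n) : 0 ≤ freqWeight s₁ s₂ η := by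
  have := Real.rpow_nonneg (angFreq_nonneg η) (2 * (s₁ - 1))
  have := Real.rpow_nonneg (angFreq_nonneg η) (2 * (s₂ - 1))
  unfold freqWeight
  split_ifs <;> positivity

lemma Exponents.continuous_freqWeight (h : Exponents n s₁ s₂) :
    Continuous (freqWeight s₁ s₂ : Rn n → ℝ) := by
  have h1 := h.one_le
  have h2 := h.le
  have := continuous_angFreq (n := n)
  unfold freqWeight
  refine (this.rpow_const fun _ => Or.inr (by linarith)).add ?_
  split_ifs
  · exact this.rpow_const fun _ => Or.inr (by linarith)
  · exact continuous_const

/-- Under contraction the smaller exponent decays most slowly, so s₁ alone governs the scaling and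
hence the growth rate of the semigroup. -/
lemma freqWeight_smul_le {c : ℝ} (hc : 0 < c) (hc1 : c ≤ 1) (η : Rn n) :
    freqWeight s₁ s₂ (c • η) ≤ c ^ (2 * (s₁ - 1)) * freqWeight s₁ s₂ η := by
  unfold freqWeight
  rw [angFreq_smul hc.le, Real.mul_rpow hc.le (angFreq_nonneg η),
    Real.mul_rpow hc.le (angFreq_nonneg η), mul_add]
  gcongr
  split_ifs
  · have := Real.rpow_nonneg (angFreq_nonneg η) (2 * (s₂ - 1))
    refine mul_le_mul_of_nonneg_right ?_ this
    exact Real.rpow_le_rpow_of_exponent_ge hc hc1 (by linarith)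
  · simp

/-- The weighted Lebesgue measure on frequency space. -/
def freqMeasure (_h : Exponents n s₁ s₂) : Measure (Rn n) :=
  volume.withDensity fun η => ENNReal.ofReal (freqWeight s₁ s₂ η)

instance (h : Exponents n s₁ s₂) : IsLocallyFiniteMeasure (freqMeasure h) :=
  IsLocallyFiniteMeasure.withDensity_ofReal h.continuous_freqWeight

lemma freqMeasure_absolutelyContinuous (h : Exponents n s₁ s₂) : freqMeasure h ≪ volume :=
  withDensity_absolutelyContinuous _ _

lemma integral_freqMeasure (h : Exponents n s₁ s₂) (f : Rn n → ℝ) :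
    ∫ η, f η ∂(freqMeasure h) = ∫ η, freqWeight s₁ s₂ η * f η := by
  rw [freqMeasure, integral_withDensity_eq_integral_toReal_smul
    h.continuous_freqWeight.measurable.ennreal_ofReal (by simp)]
  refine integral_congr_ae (Eventually.of_forall fun η => ?_)
  simp [ENNReal.toReal_ofReal (freqWeight_nonneg η)]

lemma freqWeight_le (h : Exponents n s₁ s₂) : ∃ k : ℕ, ∃ C : ℝ, 0 ≤ C ∧
    ∀ η : Rn n, freqWeight s₁ s₂ η ≤ C * (1 + ‖η‖) ^ (k : ℝ) := by
  have h1 := h.one_le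
  have h2 := h.le
  have key : ∀ p : ℝ, 0 ≤ p → ∀ k : ℕ, p ≤ k → ∀ η : Rn n,
      angFreq η ^ p ≤ (2 * Real.pi) ^ p * (1 + ‖η‖) ^ (k : ℝ) := by
    intro p hp k hk η
    rw [angFreq, Real.mul_rpow (by positivity) (by positivity)]
    gcongr
    calc ‖η‖ ^ p ≤ (1 + ‖η‖) ^ p := by gcongr; linarith
      _ ≤ _ := Real.rpow_le_rpow_of_exponent_le (by linarith [norm_nonneg η]) hk
  obtain ⟨k, hk⟩ := exists_nat_ge (2 * (s₂ - 1))
  refine ⟨k, (2 * Real.pi) ^ (2 * (s₁ - 1)) + (2 * Real.pi) ^ (2 * (s₂ - 1)), by positivity,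
    fun η => ?_⟩
  have e1 := key (2 * (s₁ - 1)) (by linarith) k (by linarith) η
  have e2 := key (2 * (s₂ - 1)) (by linarith) k hk η
  unfold freqWeight
  rw [add_mul]
  refine add_le_add e1 ?_
  split_ifs
  · exact e2
  · positivity

/-- This puts every Schwartz function in the weighted L², continuously. The order is that of
Lebesgue measure raised by the polynomial degree of the weight. -/
instance (h : Exponents n s₁ s₂) : (freqMeasure h).HasTemperateGrowth := by
  obtain ⟨k, C, hC, hk⟩ := freqWeight_le h
  set m := (volume : Measure (Rn n)).integrablePower
  refine ⟨⟨k + m, ?_⟩⟩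
  have hcont : ∀ p : ℝ, Continuous fun η : Rn n => (1 + ‖η‖) ^ p := fun p =>
    (continuous_const.add continuous_norm).rpow_const fun η =>
      Or.inl (show 1 + ‖η‖ ≠ 0 by positivity)
  rw [freqMeasure, integrable_withDensity_iff_integrable_smul'
    h.continuous_freqWeight.measurable.ennreal_ofReal (by simp)]
  refine ((Measure.integrable_pow_neg_integrablePower
    (volume : Measure (Rn n))).const_mul C).mono' ?_ (Eventually.of_forall fun η => ?_)
  · simp only [ENNReal.toReal_ofReal (freqWeight_nonneg _)]
    exact (h.continuous_freqWeight.smul (hcont _)).aestronglyMeasurable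
  · have h1 : 0 < 1 + ‖η‖ := by have := norm_nonneg η; positivity
    rw [ENNReal.toReal_ofReal (freqWeight_nonneg η), norm_smul,
      Real.norm_of_nonneg (freqWeight_nonneg η), Real.norm_of_nonneg (by positivity)]
    calc freqWeight s₁ s₂ η * (1 + ‖η‖) ^ (-((k + m : ℕ) : ℝ))
        ≤ C * (1 + ‖η‖) ^ (k : ℝ) * (1 + ‖η‖) ^ (-((k + m : ℕ) : ℝ)) := by
          gcongr
          exact hk η
      _ = _ := by
          rw [mul_assoc, ← Real.rpow_add h1]
          congr 2
          push_cast
          ring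

end Weight

/-! ### Annular amplitudes and the dilation semigroup -/

section Annular

variable {n : ℕ} {s₁ s₂ : ℝ}

/-- Values of the pair of half-wave amplitudes. -/
abbrev Amp : Type := EuclideanSpace ℂ (Fin 2)

/-- Smooth radial functions supported in an annulus around the origin. -/
def annular (n : ℕ) : Submodule ℂ (Rn n → Amp) where
  carrier := {b | ContDiff ℝ ∞ b ∧ (∃ r > 0, ∃ R, ∀ η, b η ≠ 0 → r ≤ ‖η‖ ∧ ‖η‖ ≤ R) ∧
    ∀ x y : Rn n, ‖x‖ = ‖y‖ → b x = b y}
  add_mem' := by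
    rintro f g ⟨hf, ⟨r, hr, R, hR⟩, hf''⟩ ⟨hg, ⟨r', hr', R', hR'⟩, hg''⟩
    refine ⟨hf.add hg, ⟨min r r', lt_min hr hr', max R R', fun η h => ?_⟩,
      fun x y h => by simp [hf'' x y h, hg'' x y h]⟩
    by_cases h0 : f η = 0
    · have h1 : g η ≠ 0 := fun h1 => h (by simp [h0, h1])
      exact ⟨(min_le_right _ _).trans (hR' η h1).1, (hR' η h1).2.trans (le_max_right _ _)⟩
    · exact ⟨(min_le_left _ _).trans (hR η h0).1, (hR η h0).2.trans (le_max_left _ _)⟩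
  zero_mem' := ⟨contDiff_const, ⟨1, one_pos, 1, fun η h => absurd rfl h⟩, fun _ _ _ => rfl⟩
  smul_mem' := by
    rintro c f ⟨hf, ⟨r, hr, R, hR⟩, hf''⟩
    exact ⟨hf.const_smul c, ⟨r, hr, R, fun η h => hR η fun h0 => h (by simp [h0])⟩,
      fun x y h => by simp [hf'' x y h]⟩

lemma hasCompactSupport_of_annular (b : annular n) : HasCompactSupport (b : Rn n → Amp) := by
  obtain ⟨b, hb, ⟨r, hr, R, hR⟩, hb'⟩ := b
  refine HasCompactSupport.of_support_subset_isCompact (isCompact_closedBall (0 : Rn n) R) ?_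
  intro η hη
  simpa using (hR η hη).2

/-- The radial derivative of a radial function is radial. -/
lemma fderiv_apply_self_radial {E : Type*} [NormedAddCommGroup E] [NormedSpace ℝ E] {f : Rn n → E}
    (hf : Differentiable ℝ f) (hr : ∀ x y : Rn n, ‖x‖ = ‖y‖ → f x = f y) {x y : Rn n}
    (hxy : ‖x‖ = ‖y‖) : fderiv ℝ f x x = fderiv ℝ f y y := by
  have key : ∀ z : Rn n, HasDerivAt (fun t : ℝ => f (t • z)) (fderiv ℝ f z z) 1 := by
    intro z
    have h1 : HasFDerivAt f (fderiv ℝ f z) ((1 : ℝ) • z) := by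
      rw [one_smul]
      exact (hf z).hasFDerivAt
    have h3 := h1.comp_hasDerivAt (1 : ℝ) ((hasDerivAt_id (1 : ℝ)).smul_const z)
    rw [one_smul] at h3
    exact h3
  have e : (fun t : ℝ => f (t • x)) = fun t : ℝ => f (t • y) := by
    funext t
    exact hr _ _ (by rw [norm_smul, norm_smul, hxy])
  have hx := key x
  rw [e] at hx
  exact hx.unique (key y)

/-- The dilation `b ↦ e^{(n-3)τ} b(e^τ ·)`. -/
def dilate (n : ℕ) (τ : ℝ≥0) : annular n →ₗ[ℂ] annular n where
  toFun b := ⟨fun η => Real.exp (((n : ℝ) - 3) * τ) • (b : Rn n → Amp) (Real.exp τ • η), by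
    obtain ⟨b, hb, ⟨r, hr, R, hR⟩, hb'⟩ := b
    have hp := Real.exp_pos (τ : ℝ)
    refine ⟨(hb.comp (contDiff_const_smul _)).const_smul _,
      ⟨(Real.exp τ)⁻¹ * r, by positivity, (Real.exp τ)⁻¹ * R, fun η h => ?_⟩, fun x y h => ?_⟩
    · have := hR (Real.exp τ • η) fun h0 => h (by simp [h0])
      rw [norm_smul, Real.norm_of_nonneg hp.le] at this
      constructor
      · rw [inv_mul_le_iff₀ hp]; exact this.1
      · rw [le_inv_mul_iff₀ hp]; exact this.2
    · simp only
      rw [hb' (Real.exp τ • x) (Real.exp τ • y) (by rw [norm_smul, norm_smul, h])]⟩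
  map_add' f g := by
    ext η : 2
    simp
  map_smul' c f := by
    ext η : 2
    exact smul_comm (Real.exp (((n : ℝ) - 3) * τ)) c ((f : Rn n → Amp) (Real.exp τ • η))

lemma dilate_apply (τ : ℝ≥0) (b : annular n) (η : Rn n) :
    (dilate n τ b : Rn n → Amp) η =
      Real.exp (((n : ℝ) - 3) * τ) • (b : Rn n → Amp) (Real.exp τ • η) := rfl

/-- The generator `b ↦ (n-3) b + η·∇b` of the dilations. -/
def dilateGen (n : ℕ) : annular n →ₗ[ℂ] annular n where
  toFun b := ⟨fun η => ((n : ℝ) - 3) • (b : Rn n → Amp) η + fderiv ℝ (b : Rn n → Amp) η η, by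
    obtain ⟨b, hb, ⟨r, hr, R, hR⟩, hb'⟩ := b
    refine ⟨(hb.const_smul _).add ((hb.fderiv_right (m := ∞) (by simp)).clm_apply contDiff_id),
      ⟨r, hr, R, fun η h => ?_⟩, fun x y h => ?_⟩
    · by_contra hη
      have hcl : IsClosed {η : Rn n | r ≤ ‖η‖ ∧ ‖η‖ ≤ R} :=
        (isClosed_le continuous_const continuous_norm).inter
          (isClosed_le continuous_norm continuous_const)
      have hev : b =ᶠ[𝓝 η] fun _ => 0 := by
        filter_upwards [hcl.isOpen_compl.mem_nhds hη] with ζ hζ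
        by_contra h0
        exact hζ (hR ζ h0)
      refine h ?_
      simp only [hev.fderiv_eq, hev.eq_of_nhds]
      simp
    · simp only
      rw [hb' x y h, fderiv_apply_self_radial (hb.differentiable (by simp)) hb' h]⟩
  map_add' f g := by
    ext η : 2
    have hf := (f.2.1.differentiable (by simp)) η
    have hg := (g.2.1.differentiable (by simp)) η
    simp [fderiv_add hf hg]
    abel
  map_smul' c f := by
    ext η : 2
    have hf := (f.2.1.differentiable (by simp)) η
    simp [fderiv_const_smul hf c, smul_comm c]

lemma dilateGen_apply (b : annular n) (η : Rn n) :
    (dilateGen n b : Rn n → Amp) η =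
      ((n : ℝ) - 3) • (b : Rn n → Amp) η + fderiv ℝ (b : Rn n → Amp) η η := rfl

lemma dilate_zero (b : annular n) : dilate n 0 b = b := by
  ext η : 2
  simp [dilate_apply]

lemma dilate_add (t r : ℝ≥0) (b : annular n) : dilate n (t + r) b = dilate n t (dilate n r b) := by
  ext η : 2
  simp only [dilate_apply, smul_smul, ← Real.exp_add]
  push_cast
  congr 2 <;> ring_nf

lemma hasDerivAt_dilate (b : annular n) (η : Rn n) (σ : ℝ) :
    HasDerivAt (fun σ : ℝ => Real.exp (((n : ℝ) - 3) * σ) • (b : Rn n → Amp) (Real.exp σ • η))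
      (Real.exp (((n : ℝ) - 3) * σ) • (dilateGen n b : Rn n → Amp) (Real.exp σ • η)) σ := by
  have h1 : HasDerivAt (fun σ : ℝ => Real.exp (((n : ℝ) - 3) * σ))
      (Real.exp (((n : ℝ) - 3) * σ) * ((n : ℝ) - 3)) σ := by
    simpa using ((hasDerivAt_id σ).const_mul ((n : ℝ) - 3)).exp
  have h2 := ((b.2.1.differentiable (by simp)) (Real.exp σ • η)).hasFDerivAt.comp_hasDerivAt σ
    ((Real.hasDerivAt_exp σ).smul_const η)
  have h3 := h1.smul h2
  refine h3.congr_deriv ?_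
  rw [dilateGen_apply, smul_add, smul_smul, add_comm]
  rfl

lemma memLp_annular (h : Exponents n s₁ s₂) (b : annular n) :
    MemLp (b : Rn n → Amp) 2 (freqMeasure h) :=
  b.2.1.continuous.memLp_of_hasCompactSupport (hasCompactSupport_of_annular b)

/-- The class in `L²` of an annular function. -/
def annularToLp (h : Exponents n s₁ s₂) : annular n →ₗ[ℂ] Lp Amp 2 (freqMeasure h) where
  toFun b := (memLp_annular h b).toLp _
  map_add' _ _ := rfl
  map_smul' _ _ := rfl

lemma norm_annularToLp_sq (h : Exponents n s₁ s₂) (b : annular n) :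
    ‖annularToLp h b‖ ^ 2 = ∫ η, freqWeight s₁ s₂ η * ‖(b : Rn n → Amp) η‖ ^ 2 := by
  rw [← integral_freqMeasure h]
  exact norm_toLp_two_sq (memLp_annular h b)

lemma integrable_freqWeight_mul (h : Exponents n s₁ s₂) (b : annular n) :
    Integrable fun η => freqWeight s₁ s₂ η * ‖(b : Rn n → Amp) η‖ ^ 2 := by
  refine (h.continuous_freqWeight.mul (b.2.1.continuous.norm.pow 2)).integrable_of_hasCompactSupport
    ?_
  refine (hasCompactSupport_of_annular b).mono fun η hη h0 => hη ?_
  simp [show (b : Rn n → Amp) η = 0 from h0]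

/-- After ζ = e^τ η the squared norm carries the exponents 2(n - 3) from the prefactor, -n from the
Jacobian and -2(s₁ - 1) from the weight; their sum is 2(n/2 - 2 - s₁). -/
lemma norm_annularToLp_dilate_le (h : Exponents n s₁ s₂) (τ : ℝ≥0) (b : annular n) :
    ‖annularToLp h (dilate n τ b)‖ ≤
      Real.exp (((n : ℝ) / 2 - 2 - s₁) * τ) * ‖annularToLp h b‖ := by
  refine le_of_sq_le_sq ?_ (by positivity)
  rw [mul_pow, norm_annularToLp_sq, norm_annularToLp_sq]
  have hp := Real.exp_pos (τ : ℝ)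
  set c := Real.exp (-(τ : ℝ)) with hc
  have hc1 : c ≤ 1 := by rw [hc, Real.exp_le_one_iff]; simp
  have hcp : 0 < c := Real.exp_pos _
  have hcc : c * Real.exp τ = 1 := by rw [hc, ← Real.exp_add]; simp
  calc ∫ η, freqWeight s₁ s₂ η * ‖(dilate n τ b : Rn n → Amp) η‖ ^ 2
      = ∫ η, (fun ζ => Real.exp (((n : ℝ) - 3) * τ) ^ 2 *
          (freqWeight s₁ s₂ (c • ζ) * ‖(b : Rn n → Amp) ζ‖ ^ 2)) (Real.exp τ • η) := by
        refine integral_congr_ae (Eventually.of_forall fun η => ?_)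
        simp only [dilate_apply, smul_smul, hcc, one_smul]
        rw [norm_smul, mul_pow, Real.norm_of_nonneg (Real.exp_pos _).le]
        ring
    _ = (Real.exp τ ^ n)⁻¹ * (Real.exp (((n : ℝ) - 3) * τ) ^ 2 *
          ∫ ζ, freqWeight s₁ s₂ (c • ζ) * ‖(b : Rn n → Amp) ζ‖ ^ 2) := by
        rw [Measure.integral_comp_smul_of_nonneg volume
          (fun ζ : Rn n => Real.exp (((n : ℝ) - 3) * τ) ^ 2 *
            (freqWeight s₁ s₂ (c • ζ) * ‖(b : Rn n → Amp) ζ‖ ^ 2)) (Real.exp τ) (hR := hp.le),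
          finrank_euclideanSpace_fin, integral_const_mul,
          smul_eq_mul]
    _ ≤ (Real.exp τ ^ n)⁻¹ * (Real.exp (((n : ℝ) - 3) * τ) ^ 2 *
          ∫ ζ, c ^ (2 * (s₁ - 1)) * (freqWeight s₁ s₂ ζ * ‖(b : Rn n → Amp) ζ‖ ^ 2)) := by
        refine mul_le_mul_of_nonneg_left (mul_le_mul_of_nonneg_left ?_ (by positivity))
          (by positivity)
        refine integral_mono_of_nonneg (Eventually.of_forall fun ζ => ?_)
          ((integrable_freqWeight_mul h b).const_mul _) (Eventually.of_forall fun ζ => ?_)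
        · exact mul_nonneg (freqWeight_nonneg _) (by positivity)
        · simp only
          rw [← mul_assoc]
          exact mul_le_mul_of_nonneg_right (freqWeight_smul_le hcp hc1 ζ) (by positivity)
    _ = Real.exp (((n : ℝ) / 2 - 2 - s₁) * τ) ^ 2 *
          ∫ ζ, freqWeight s₁ s₂ ζ * ‖(b : Rn n → Amp) ζ‖ ^ 2 := by
        rw [integral_const_mul, ← mul_assoc, ← mul_assoc]
        congr 1
        rw [hc, ← Real.exp_mul, ← Real.exp_nat_mul, ← Real.exp_nat_mul, ← Real.exp_nat_mul,
          ← Real.exp_neg, ← Real.exp_add, ← Real.exp_add]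
        congr 1
        push_cast
        ring

/-- The mean value inequality in τ gives one dominating function for all difference quotients with 0
< τ ≤ 1. -/
lemma exists_norm_dilate_sub_le (b : annular n) : ∃ C R : ℝ, 0 ≤ C ∧ ∀ τ : ℝ≥0, τ ≤ 1 → ∀ η,
    ‖(dilate n τ b : Rn n → Amp) η - (b : Rn n → Amp) η‖ ≤
      (Metric.closedBall 0 R).indicator (fun _ => C) η * τ := by
  obtain ⟨R, hR⟩ : ∃ R, ∀ η, (dilateGen n b : Rn n → Amp) η ≠ 0 → ‖η‖ ≤ R := by
    obtain ⟨r, -, R, hR⟩ := (dilateGen n b).2.2.1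
    exact ⟨R, fun η hη => (hR η hη).2⟩
  obtain ⟨C, hC⟩ := (dilateGen n b).2.1.continuous.bounded_above_of_compact_support
    (hasCompactSupport_of_annular _)
  have hC0 : 0 ≤ C := (norm_nonneg _).trans (hC 0)
  refine ⟨Real.exp |(n : ℝ) - 3| * C, R, by positivity, fun τ hτ η => ?_⟩
  have hτ' : (τ : ℝ) ≤ 1 := hτ
  have := norm_image_sub_le_of_norm_deriv_le_segment'
    (f := fun σ : ℝ => Real.exp (((n : ℝ) - 3) * σ) • (b : Rn n → Amp) (Real.exp σ • η))
    (f' := fun σ => Real.exp (((n : ℝ) - 3) * σ) • (dilateGen n b : Rn n → Amp) (Real.exp σ • η))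
    (a := 0) (b := (τ : ℝ))
    (C := (Metric.closedBall 0 R).indicator (fun _ => Real.exp |(n : ℝ) - 3| * C) η)
    (fun σ _ => (hasDerivAt_dilate b η σ).hasDerivWithinAt) ?_ τ ⟨τ.coe_nonneg, le_rfl⟩
  · simpa [dilate_apply] using this
  · intro σ hσ
    have hσ1 : σ ≤ 1 := hσ.2.le.trans hτ'
    by_cases h0 : (dilateGen n b : Rn n → Amp) (Real.exp σ • η) = 0
    · rw [h0, smul_zero, norm_zero]
      exact Set.indicator_nonneg (fun _ _ => by positivity) _
    · have h1 := hR _ h0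
      rw [norm_smul, Real.norm_of_nonneg (Real.exp_pos _).le] at h1
      -- Since σ ≥ 0, ‖η‖ ≤ e^σ‖η‖ ≤ R: the dilations only shrink supports towards the origin, so
      -- one ball serves all σ.
      have h2 : ‖η‖ ≤ R := by
        have := Real.one_le_exp hσ.1
        nlinarith [norm_nonneg η]
      rw [Set.indicator_of_mem (by simpa using h2), norm_smul,
        Real.norm_of_nonneg (Real.exp_pos _).le]
      refine mul_le_mul ?_ (hC _) (norm_nonneg _) (Real.exp_pos _).le
      rw [Real.exp_le_exp]
      calc ((n : ℝ) - 3) * σ ≤ |(n : ℝ) - 3| * 1 :=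
            mul_le_mul (le_abs_self _) hσ1 hσ.1 (abs_nonneg _)
        _ = _ := mul_one _

lemma tendsto_dilate (h : Exponents n s₁ s₂) (b : annular n) :
    Tendsto (fun τ : ℝ≥0 => ((τ⁻¹ : ℝ≥0) : ℂ) •
      (annularToLp h (dilate n τ b) - annularToLp h b)) (𝓝[>] 0)
      (𝓝 (annularToLp h (dilateGen n b))) := by
  have e : ∀ τ : ℝ≥0, ((τ⁻¹ : ℝ≥0) : ℂ) • (annularToLp h (dilate n τ b) - annularToLp h b) =
      annularToLp h (((τ⁻¹ : ℝ≥0) : ℂ) • (dilate n τ b - b)) := by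
    intro τ
    rw [map_smul, map_sub]
  simp only [e]
  obtain ⟨C, R, hC, hCR⟩ := exists_norm_dilate_sub_le b
  have hval : ∀ (τ : ℝ≥0) (η : Rn n),
      ((((τ⁻¹ : ℝ≥0) : ℂ) • (dilate n τ b - b) : annular n) : Rn n → Amp) η =
      (τ : ℝ)⁻¹ • ((dilate n τ b : Rn n → Amp) η - (b : Rn n → Amp) η) := by
    intro τ η
    rw [← NNReal.coe_inv, ← Complex.coe_smul]
    rfl
  refine tendsto_toLp_two_of_dominated (fun τ => memLp_annular h _) (memLp_annular h _)
    (g := fun η => (Metric.closedBall 0 R).indicator (fun _ => C) η +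
      ‖(dilateGen n b : Rn n → Amp) η‖) ?_ ?_ (Eventually.of_forall fun η => ?_)
  · exact (memLp_indicator_const 2 measurableSet_closedBall C
      (Or.inr (isCompact_closedBall _ _).measure_lt_top.ne)).add (memLp_annular h _).norm
  · filter_upwards [self_mem_nhdsWithin, nhdsWithin_le_nhds
      (Iic_mem_nhds (show (0 : ℝ≥0) < 1 by norm_num))] with τ hτ hτ1
    refine Eventually.of_forall fun η => ?_
    rw [hval]
    refine (norm_sub_le _ _).trans (add_le_add_left ?_ _)
    have hpos : (0 : ℝ) < τ := hτ
    rw [norm_smul, Real.norm_of_nonneg (by positivity), inv_mul_le_iff₀ hpos, mul_comm]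
    exact hCR τ hτ1 η
  · simp only [hval]
    have h1 := (hasDerivAt_dilate b η 0).tendsto_slope_zero_right
    have h3 : Tendsto (fun t : ℝ≥0 => (t : ℝ)) (𝓝[>] 0) (𝓝[>] 0) := by
      refine tendsto_nhdsWithin_iff.2 ⟨?_, ?_⟩
      · exact (NNReal.continuous_coe.tendsto' 0 0 rfl).mono_left nhdsWithin_le_nhds
      · filter_upwards [self_mem_nhdsWithin] with t ht
        simpa using ht
    simpa [Function.comp_def, dilate_apply] using h1.comp h3

end Annular

open scoped SchwartzMap LineDeriv Laplacian

variable {n : ℕ} {s₁ s₂ : ℝ}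

/-! ### The wave operator on Schwartz functions and its Fourier transform -/

section SchwartzOperators

/-- The Euler operator `xⁱ∂ᵢ` on Schwartz functions. -/
def euler (f : 𝓢(Rn n, ℂ)) : 𝓢(Rn n, ℂ) :=
  ∑ i, SchwartzMap.smulLeftCLM ℂ (inner ℝ · (EuclideanSpace.basisFun (Fin n) ℝ i))
    (∂_{EuclideanSpace.basisFun (Fin n) ℝ i} f)

lemma continuous_euler : Continuous (euler : 𝓢(Rn n, ℂ) → 𝓢(Rn n, ℂ)) := by
  unfold euler
  refine continuous_finsetSum _ fun i _ => (ContinuousLinearMap.continuous _).comp ?_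
  exact LineDeriv.continuous_lineDerivOp _

lemma fderiv_apply_self_eq_sum {E : Type*} [NormedAddCommGroup E] [NormedSpace ℝ E]
    (L : Rn n →L[ℝ] E) (x : Rn n) :
    L x = ∑ i, inner ℝ x (EuclideanSpace.basisFun (Fin n) ℝ i) •
      L (EuclideanSpace.basisFun (Fin n) ℝ i) := by
  conv_lhs => rw [← (EuclideanSpace.basisFun (Fin n) ℝ).sum_repr' x]
  simp only [map_sum, map_smul, real_inner_comm]

lemma euler_apply (f : 𝓢(Rn n, ℂ)) (x : Rn n) : euler f x = fderiv ℝ f x x := by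
  rw [fderiv_apply_self_eq_sum (fderiv ℝ f x) x, euler, _root_.sum_apply]
  refine Finset.sum_congr rfl fun i _ => ?_
  rw [SchwartzMap.smulLeftCLM_apply_apply (by fun_prop), SchwartzMap.lineDerivOp_apply_eq_fderiv]

/-- The Fourier transform exchanges multiplication and differentiation: xᵢ∂ᵢ becomes -∂ᵢ(ηᵢ ·), and
the product rule produces one copy of the transform per coordinate, hence the n. -/
lemma fourier_euler_apply (f : 𝓢(Rn n, ℂ)) (η : Rn n) :
    𝓕 (euler f) η = -((n : ℂ) * 𝓕 f η + fderiv ℝ (𝓕 f : 𝓢(Rn n, ℂ)) η η) := by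
  set e := EuclideanSpace.basisFun (Fin n) ℝ with he
  have hpi : (2 * Real.pi * Complex.I : ℂ) ≠ 0 := by
    simp [Real.pi_ne_zero]
  have h1 : ∀ i, 𝓕 (SchwartzMap.smulLeftCLM ℂ (inner ℝ · (e i)) (∂_{e i} f)) =
      -∂_{e i} (SchwartzMap.smulLeftCLM ℂ (inner ℝ · (e i)) (𝓕 f)) := by
    intro i
    have h := SchwartzMap.lineDerivOp_fourier_eq (∂_{e i} f) (e i)
    rw [SchwartzMap.fourier_lineDerivOp_eq, LineDeriv.lineDerivOp_smul, FourierTransform.fourier_smul,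
      neg_smul] at h
    have h' := congrArg (fun g => (2 * Real.pi * Complex.I : ℂ)⁻¹ • g) h
    simp only [smul_neg, smul_smul, inv_mul_cancel₀ hpi, one_smul] at h'
    rw [h', neg_neg]
  have h2 : ∀ i, (∂_{e i} (SchwartzMap.smulLeftCLM ℂ (inner ℝ · (e i)) (𝓕 f)) : 𝓢(Rn n, ℂ)) η =
      𝓕 f η + inner ℝ η (e i) • fderiv ℝ (𝓕 f : 𝓢(Rn n, ℂ)) η (e i) := by
    intro i
    rw [SchwartzMap.lineDerivOp_apply_eq_fderiv, SchwartzMap.smulLeftCLM_apply (by fun_prop)]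
    have hd : HasFDerivAt (fun x : Rn n => inner ℝ x (e i)) ((innerSL ℝ).flip (e i)) η :=
      ((innerSL ℝ).flip (e i)).hasFDerivAt
    have := (hd.smul ((𝓕 f).hasFDerivAt η)).fderiv
    have h3 : (fun x : Rn n => inner ℝ x (e i) • (𝓕 f) x) =
      (fun x : Rn n => inner ℝ x (e i)) • ⇑(𝓕 f : 𝓢(Rn n, ℂ)) := rfl
    have h4 : innerSL ℝ (e i) (e i) = 1 := by
      simp [innerSL_apply_apply ℝ]
    rw [h3, this]
    simp [h4, add_comm]
  have h3 : 𝓕 (euler f) = ∑ i, 𝓕 (SchwartzMap.smulLeftCLM ℂ (inner ℝ · (e i)) (∂_{e i} f)) := by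
    rw [euler]
    exact map_sum (SchwartzMap.fourierTransformCLM ℂ) _ _
  rw [h3, _root_.sum_apply, fderiv_apply_self_eq_sum (fderiv ℝ (𝓕 f : 𝓢(Rn n, ℂ)) η) η]
  simp only [h1, _root_.neg_apply, h2, Finset.sum_neg_distrib, Finset.sum_add_distrib]
  simp [he]

lemma fourier_laplacian_apply (f : 𝓢(Rn n, ℂ)) (η : Rn n) :
    𝓕 (Δ f) η = -(angFreq η : ℂ) ^ 2 * 𝓕 f η := by
  rw [SchwartzMap.laplacian_eq_fourierMultiplierCLM, SchwartzMap.fourierMultiplierCLM_apply,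
    FourierTransform.fourier_smul, FourierTransform.fourier_fourierInv_eq, _root_.smul_apply,
    SchwartzMap.smulLeftCLM_apply_apply (by fun_prop), angFreq, smul_smul, Complex.real_smul]
  push_cast
  ring

/-- The free wave operator in similarity variables on Schwartz functions. -/
def waveSchwartz (u : 𝓢(Rn n, ℂ) × 𝓢(Rn n, ℂ)) : 𝓢(Rn n, ℂ) × 𝓢(Rn n, ℂ) :=
  (-euler u.1 - (2 : ℂ) • u.1 + u.2, Δ u.1 - euler u.2 - (3 : ℂ) • u.2)

lemma continuous_laplacian : Continuous fun f : 𝓢(Rn n, ℂ) => (Δ f : 𝓢(Rn n, ℂ)) := by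
  have := (LineDeriv.laplacianCLM ℝ (Rn n) 𝓢(Rn n, ℂ)).continuous
  exact this

lemma continuous_waveSchwartz :
    Continuous (waveSchwartz : 𝓢(Rn n, ℂ) × 𝓢(Rn n, ℂ) → 𝓢(Rn n, ℂ) × 𝓢(Rn n, ℂ)) := by
  have h1 := continuous_euler (n := n)
  have h2 := continuous_laplacian (n := n)
  unfold waveSchwartz
  fun_prop

lemma toSchwartz_lam (f : radialTest n) : toSchwartz (lam n f) = euler (toSchwartz f) := by
  ext x
  rw [euler_apply]
  rfl

lemma toSchwartz_lap (f : radialTest n) : toSchwartz (lap n f) = Δ (toSchwartz f) := by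
  ext x
  rw [SchwartzMap.laplacian_apply]
  rfl

/-- The pair of Schwartz functions given by a pair of test functions. -/
def pairSchwartz (h : Exponents n s₁ s₂) : TestPair h →ₗ[ℂ] 𝓢(Rn n, ℂ) × 𝓢(Rn n, ℂ) where
  toFun u := (toSchwartz u.1, toSchwartz u.2)
  map_add' _ _ := rfl
  map_smul' _ _ := rfl

lemma pairSchwartz_freeWave (h : Exponents n s₁ s₂) (u : TestPair h) :
    pairSchwartz h (freeWave h u) = waveSchwartz (pairSchwartz h u) := by
  refine Prod.ext ?_ ?_
  · change toSchwartz (-lam n u.1 - (2 : ℂ) • u.1 + u.2) = _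
    have : toSchwartz (-lam n u.1 - (2 : ℂ) • u.1 + u.2) =
      -toSchwartz (lam n u.1) - (2 : ℂ) • toSchwartz u.1 + toSchwartz u.2 := rfl
    rw [this, toSchwartz_lam]
    rfl
  · change toSchwartz (lap n u.1 - lam n u.2 - (3 : ℂ) • u.2) = _
    have : toSchwartz (lap n u.1 - lam n u.2 - (3 : ℂ) • u.2) =
      toSchwartz (lap n u.1) - toSchwartz (lam n u.2) - (3 : ℂ) • toSchwartz u.2 := rfl
    rw [this, toSchwartz_lam, toSchwartz_lap]
    rfl

end SchwartzOperators

/-! ### Half-wave amplitudes -/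

section HalfWave

/-- The signs of the two half-waves. -/
def halfSign : Fin 2 → ℂ := ![1, -1]

lemma halfSign_mul_self (i : Fin 2) : halfSign i * halfSign i = 1 := by
  fin_cases i <;> simp [halfSign]

/-- The half-wave amplitudes `e^{∓iρ}(ρp ± iq)/√2`. -/
def halfAmp (ρ : ℝ) (p q : ℂ) : Amp :=
  WithLp.toLp 2 fun i => ((√2 : ℝ) : ℂ)⁻¹ *
    (Complex.exp (-(halfSign i * Complex.I * ρ)) * (ρ * p + halfSign i * Complex.I * q))

lemma halfAmp_apply (ρ : ℝ) (p q : ℂ) (i : Fin 2) : halfAmp ρ p q i = ((√2 : ℝ) : ℂ)⁻¹ *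
    (Complex.exp (-(halfSign i * Complex.I * ρ)) * (ρ * p + halfSign i * Complex.I * q)) := rfl

/-- The phases have modulus one, so this is the parallelogram law for ρp and iq; the 1/√2 absorbs
its factor 2. -/
lemma norm_halfAmp_sq (ρ : ℝ) (p q : ℂ) :
    ‖halfAmp ρ p q‖ ^ 2 = ρ ^ 2 * ‖p‖ ^ 2 + ‖q‖ ^ 2 := by
  have e1 : ‖Complex.exp (-(Complex.I * ρ))‖ = 1 := by simp [Complex.norm_exp]
  have e2 : ‖Complex.exp (Complex.I * ρ)‖ = 1 := by simp [Complex.norm_exp]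
  rw [EuclideanSpace.norm_sq_eq, Fin.sum_univ_two, halfAmp_apply, halfAmp_apply]
  simp only [halfSign, Matrix.cons_val_zero, Matrix.cons_val_one, norm_mul, norm_inv, mul_pow,
    one_mul, neg_mul, neg_neg, e1, e2, Complex.norm_real, Real.norm_of_nonneg (Real.sqrt_nonneg 2),
    inv_pow, Real.sq_sqrt zero_le_two]
  rw [← sub_eq_add_neg]
  have h := parallelogram_law_with_norm ℝ ((ρ : ℂ) * p) (Complex.I * q)
  simp only [norm_mul, Complex.norm_I, one_mul, Complex.norm_real, Real.norm_eq_abs] at h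
  rw [← sq_abs ρ]
  linear_combination (1 / 2 : ℝ) * h

/-- The half-wave amplitudes of a pair of Schwartz functions. -/
def halfWave (u : 𝓢(Rn n, ℂ) × 𝓢(Rn n, ℂ)) (η : Rn n) : Amp :=
  halfAmp (angFreq η) (𝓕 u.1 η) (𝓕 u.2 η)

lemma continuous_halfWave (u : 𝓢(Rn n, ℂ) × 𝓢(Rn n, ℂ)) : Continuous (halfWave u) := by
  have h1 := continuous_angFreq (n := n)
  have h2 := (𝓕 u.1).continuous
  have h3 := (𝓕 u.2).continuous
  unfold halfWave halfAmp
  refine (PiLp.continuous_toLp 2 _).comp (continuous_pi fun i => ?_)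
  fun_prop

lemma contDiffAt_angFreq {η : Rn n} (hη : η ≠ 0) : ContDiffAt ℝ ∞ (angFreq : Rn n → ℝ) η :=
  contDiffAt_const.mul (contDiffAt_norm ℝ hη)

lemma contDiffAt_ofReal_angFreq {η : Rn n} (hη : η ≠ 0) :
    ContDiffAt ℝ ∞ (fun η : Rn n => (angFreq η : ℂ)) η :=
  Complex.ofRealCLM.contDiff.contDiffAt.comp η (contDiffAt_angFreq hη)

lemma contDiffAt_halfWave (u : 𝓢(Rn n, ℂ) × 𝓢(Rn n, ℂ)) {η : Rn n} (hη : η ≠ 0) :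
    ContDiffAt ℝ ∞ (halfWave u) η := by
  have h1 := contDiffAt_ofReal_angFreq hη
  have h2 : ContDiffAt ℝ ∞ (𝓕 u.1 : 𝓢(Rn n, ℂ)) η := (𝓕 u.1).contDiffAt ⊤
  have h3 : ContDiffAt ℝ ∞ (𝓕 u.2 : 𝓢(Rn n, ℂ)) η := (𝓕 u.2).contDiffAt ⊤
  refine (PiLp.continuousLinearEquiv 2 ℝ (fun _ : Fin 2 => ℂ)).symm.contDiff.contDiffAt.comp η
    (contDiffAt_pi.2 fun i => ?_)
  exact contDiffAt_const.mul (((contDiffAt_const.mul h1).neg.cexp).mul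
    ((h1.mul h2).add (contDiffAt_const.mul h3)))

/-- In terms of half-wave amplitudes, the free wave operator generates dilations. -/
lemma halfWave_waveSchwartz (u : 𝓢(Rn n, ℂ) × 𝓢(Rn n, ℂ)) {η : Rn n} (hη : η ≠ 0) :
    halfWave (waveSchwartz u) η =
      ((n : ℝ) - 3) • halfWave u η + fderiv ℝ (halfWave u) η η := by
  -- η·∇ is d/dt at t = 1 along the ray t ↦ tη, on which ρ becomes tρ; this reduces the claim to
  -- calculus in one variable.
  have hray : ∀ {E : Type} [NormedAddCommGroup E] [NormedSpace ℝ E] {f : Rn n → E},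
      DifferentiableAt ℝ f η → HasDerivAt (fun t : ℝ => f (t • η)) (fderiv ℝ f η η) 1 := by
    intro E _ _ f hf
    have h1 : HasFDerivAt f (fderiv ℝ f η) ((1 : ℝ) • η) := by
      rw [one_smul]
      exact hf.hasFDerivAt
    have h3 := h1.comp_hasDerivAt (1 : ℝ) ((hasDerivAt_id (1 : ℝ)).smul_const η)
    rw [one_smul] at h3
    exact h3
  set ρ := angFreq η with hρ
  have hP := hray (𝓕 u.1).differentiableAt
  have hQ := hray (𝓕 u.2).differentiableAt
  have hB := hray ((contDiffAt_halfWave u hη).differentiableAt (by simp))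
  have f1 : 𝓕 (waveSchwartz u).1 η = ((n : ℂ) * 𝓕 u.1 η + fderiv ℝ (𝓕 u.1 : 𝓢(Rn n, ℂ)) η η) - 2 * 𝓕 u.1 η
      + 𝓕 u.2 η := by
    have : 𝓕 (waveSchwartz u).1 = -𝓕 (euler u.1) - (2 : ℂ) • 𝓕 u.1 + 𝓕 u.2 := by
      simp only [waveSchwartz, ← SchwartzMap.fourierTransformCLM_apply ℂ, map_add, map_sub, map_neg,
        map_smul]
    rw [this]
    simp only [_root_.add_apply, _root_.sub_apply, _root_.neg_apply,
      _root_.smul_apply, fourier_euler_apply, smul_eq_mul]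
    ring
  have f2 : 𝓕 (waveSchwartz u).2 η = -(ρ : ℂ) ^ 2 * 𝓕 u.1 η +
      ((n : ℂ) * 𝓕 u.2 η + fderiv ℝ (𝓕 u.2 : 𝓢(Rn n, ℂ)) η η) - 3 * 𝓕 u.2 η := by
    have : 𝓕 (waveSchwartz u).2 = 𝓕 (Δ u.1) - 𝓕 (euler u.2) - (3 : ℂ) • 𝓕 u.2 := by
      simp only [waveSchwartz, ← SchwartzMap.fourierTransformCLM_apply ℂ, map_sub,
        map_smul]
    rw [this]
    simp only [_root_.sub_apply, _root_.smul_apply, fourier_euler_apply,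
      fourier_laplacian_apply, smul_eq_mul]
    ring
  ext i
  have hBi : HasDerivAt (fun t : ℝ => halfWave u (t • η) i) (fderiv ℝ (halfWave u) η η i) 1 :=
    (PiLp.proj (𝕜 := ℝ) 2 (fun _ : Fin 2 => ℂ) i).hasFDerivAt.comp_hasDerivAt 1 hB
  set P' := fderiv ℝ (𝓕 u.1 : 𝓢(Rn n, ℂ)) η η
  set Q' := fderiv ℝ (𝓕 u.2 : 𝓢(Rn n, ℂ)) η η
  have hid : HasDerivAt (fun t : ℝ => ((t : ℝ) : ℂ) * (ρ : ℂ)) ρ 1 := by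
    simpa using (Complex.ofRealCLM.hasDerivAt (x := (1 : ℝ))).mul_const (ρ : ℂ)
  have hform := ((hid.const_mul (halfSign i * Complex.I)).neg.cexp.mul
    ((hid.mul hP).add (hQ.const_mul (halfSign i * Complex.I)))).const_mul (((√2 : ℝ) : ℂ)⁻¹)
  -- The frequency at tη is |t|ρ, so the formula with tρ is used only near t = 1.
  have hev : (fun t : ℝ => halfWave u (t • η) i) =ᶠ[𝓝 1] fun t : ℝ => ((√2 : ℝ) : ℂ)⁻¹ *
      (Complex.exp (-(halfSign i * Complex.I * ((t : ℝ) * ρ))) *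
        ((t : ℝ) * ρ * 𝓕 u.1 (t • η) + halfSign i * Complex.I * 𝓕 u.2 (t • η))) := by
    filter_upwards [lt_mem_nhds (show (0 : ℝ) < 1 by norm_num)] with t ht
    simp only [halfWave, halfAmp_apply, angFreq_smul ht.le, ← hρ]
    push_cast
    rfl
  have huniq := hBi.unique (hform.congr_of_eventuallyEq hev)
  rw [PiLp.add_apply, PiLp.smul_apply, huniq, halfWave, halfAmp_apply, f1, f2, halfWave,
    halfAmp_apply, ← hρ, Complex.real_smul]
  simp only [Pi.mul_apply, Pi.add_apply, Pi.neg_apply, Complex.ofReal_one, one_mul, one_smul]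
  push_cast
  have hs := halfSign_mul_self i
  have hI := Complex.I_mul_I
  -- The -ρ²p term agrees identically with the derivative of the phase; only the ρq term needs (±i)²
  -- = -1.
  linear_combination (((√2 : ℝ) : ℂ)⁻¹ * Complex.exp (-(halfSign i * Complex.I * ρ)) * ρ * 𝓕 u.2 η) *
    (Complex.I * Complex.I * hs + hI)

/-- The factor ρ is not smooth at 0, but ρ ≤ 1 + ρ², the symbol of 1 - Δ. Integrability and
continuity in the Schwartz topology then reduce to those of Schwartz functions. -/
lemma norm_halfWave_le (u : 𝓢(Rn n, ℂ) × 𝓢(Rn n, ℂ)) (η : Rn n) :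
    ‖halfWave u η‖ ≤ ‖𝓕 (u.1 - Δ u.1) η‖ + ‖𝓕 u.2 η‖ := by
  have e : 𝓕 (u.1 - Δ u.1) η = ((1 + angFreq η ^ 2 : ℝ) : ℂ) * 𝓕 u.1 η := by
    have : 𝓕 (u.1 - Δ u.1) = 𝓕 u.1 - 𝓕 (Δ u.1) := by
      simp only [← SchwartzMap.fourierTransformCLM_apply ℂ, map_sub]
    rw [this, _root_.sub_apply, fourier_laplacian_apply]
    push_cast
    ring
  have h0 := angFreq_nonneg η
  rw [e, norm_mul, Complex.norm_real, Real.norm_of_nonneg (by positivity)]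
  refine le_of_sq_le_sq ?_ (by positivity)
  rw [halfWave, norm_halfAmp_sq]
  set p := ‖𝓕 u.1 η‖
  set q := ‖𝓕 u.2 η‖
  have hp : 0 ≤ p := norm_nonneg _
  have hq : 0 ≤ q := norm_nonneg _
  set r := angFreq η
  have h1 : r * p ≤ (1 + r ^ 2) * p := by
    gcongr
    nlinarith [sq_nonneg (r - 1)]
  have h2 : (r * p) ^ 2 ≤ ((1 + r ^ 2) * p) ^ 2 := by gcongr
  have h3 : 0 ≤ (1 + r ^ 2) * p * q := by positivity
  nlinarith

lemma memLp_halfWave (h : Exponents n s₁ s₂) (u : 𝓢(Rn n, ℂ) × 𝓢(Rn n, ℂ)) :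
    MemLp (halfWave u) 2 (freqMeasure h) := by
  refine (((𝓕 (u.1 - Δ u.1)).memLp 2 (freqMeasure h)).norm.add
    ((𝓕 u.2).memLp 2 (freqMeasure h)).norm).mono (continuous_halfWave u).aestronglyMeasurable
    (Eventually.of_forall fun η => ?_)
  refine (norm_halfWave_le u η).trans (le_abs_self _)

/-- The class in `L²` of the half-wave amplitudes. -/
def halfWaveLp (h : Exponents n s₁ s₂) :
    𝓢(Rn n, ℂ) × 𝓢(Rn n, ℂ) →ₗ[ℂ] Lp Amp 2 (freqMeasure h) where
  toFun u := (memLp_halfWave h u).toLp _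
  map_add' u v := by
    rw [← MemLp.toLp_add]
    congr 1
    ext η i
    have h1 : 𝓕 (u + v).1 = 𝓕 u.1 + 𝓕 v.1 := FourierTransform.fourier_add _ _
    have h2 : 𝓕 (u + v).2 = 𝓕 u.2 + 𝓕 v.2 := FourierTransform.fourier_add _ _
    simp only [halfWave, halfAmp_apply, Pi.add_apply, PiLp.add_apply, h1, h2, _root_.add_apply]
    ring
  map_smul' c u := by
    rw [RingHom.id_apply, ← MemLp.toLp_const_smul]
    congr 1
    ext η i
    have h1 : 𝓕 (c • u).1 = c • 𝓕 u.1 := FourierTransform.fourier_smul _ _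
    have h2 : 𝓕 (c • u).2 = c • 𝓕 u.2 := FourierTransform.fourier_smul _ _
    simp only [halfWave, halfAmp_apply, Pi.smul_apply, PiLp.smul_apply, h1, h2,
      _root_.smul_apply, smul_eq_mul]
    ring

lemma norm_halfWaveLp_le (h : Exponents n s₁ s₂) (u : 𝓢(Rn n, ℂ) × 𝓢(Rn n, ℂ)) :
    ‖halfWaveLp h u‖ ≤ ‖(𝓕 (u.1 - Δ u.1)).toLp 2 (freqMeasure h)‖ +
      ‖(𝓕 u.2).toLp 2 (freqMeasure h)‖ := by
  have h1 := ((𝓕 (u.1 - Δ u.1)).memLp 2 (freqMeasure h)).norm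
  have h2 := ((𝓕 u.2).memLp 2 (freqMeasure h)).norm
  have h3 : ‖halfWaveLp h u‖ ≤ ‖(h1.add h2).toLp _‖ := by
    refine Lp.norm_le_norm_of_ae_le ?_
    filter_upwards [(memLp_halfWave h u).coeFn_toLp, (h1.add h2).coeFn_toLp] with η e1 e2
    rw [e2]
    change ‖(memLp_halfWave h u).toLp _ η‖ ≤ _
    rw [e1]
    exact (norm_halfWave_le u η).trans (le_abs_self _)
  refine h3.trans ?_
  rw [MemLp.toLp_add h1 h2]
  refine (norm_add_le _ _).trans (le_of_eq ?_)
  rw [Lp.norm_toLp, Lp.norm_toLp, eLpNorm_norm, eLpNorm_norm, SchwartzMap.norm_toLp,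
    SchwartzMap.norm_toLp]

lemma continuous_halfWaveLp (h : Exponents n s₁ s₂) : Continuous (halfWaveLp h) := by
  refine continuous_of_continuousAt_zero (halfWaveLp h) ?_
  rw [ContinuousAt, map_zero, tendsto_zero_iff_norm_tendsto_zero]
  refine squeeze_zero (fun _ => norm_nonneg _) (norm_halfWaveLp_le h) ?_
  have c0 := continuous_laplacian (n := n)
  have c1 := (SchwartzMap.fourierTransformCLM ℂ (V := Rn n) (E := ℂ)).continuous
  have c2 := (SchwartzMap.toLpCLM ℂ ℂ (E := Rn n) 2 (freqMeasure h)).continuous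
  have c3 : Continuous fun u : 𝓢(Rn n, ℂ) × 𝓢(Rn n, ℂ) =>
      ‖(𝓕 (u.1 - Δ u.1)).toLp 2 (freqMeasure h)‖ + ‖(𝓕 u.2).toLp 2 (freqMeasure h)‖ :=
    (c2.comp (c1.comp (continuous_fst.sub (c0.comp continuous_fst)))).norm.add
      (c2.comp (c1.comp continuous_snd)).norm
  refine c3.tendsto' 0 0 ?_
  have e1 : 𝓕 ((0 : 𝓢(Rn n, ℂ) × 𝓢(Rn n, ℂ)).1 - Δ (0 : 𝓢(Rn n, ℂ) × 𝓢(Rn n, ℂ)).1) = 0 := by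
    have : (Δ (0 : 𝓢(Rn n, ℂ)) : 𝓢(Rn n, ℂ)) = 0 :=
      (LineDeriv.laplacianCLM ℝ (Rn n) 𝓢(Rn n, ℂ)).map_zero
    rw [Prod.fst_zero, this, sub_zero, FourierTransform.fourier_zero]
  have e2 : 𝓕 (0 : 𝓢(Rn n, ℂ) × 𝓢(Rn n, ℂ)).2 = 0 := FourierTransform.fourier_zero
  rw [e1, e2]
  have e3 : (0 : 𝓢(Rn n, ℂ)).toLp 2 (freqMeasure h) = 0 :=
    (SchwartzMap.toLpCLM ℂ ℂ (E := Rn n) 2 (freqMeasure h)).map_zero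
  rw [e3]
  simp

end HalfWave

/-! ### The Sobolev norm in terms of amplitudes -/

section Norm

/-- The substitution ξ = 2πη passes between the two Fourier normalisations; the factor (2π)⁻ⁿ will
cancel the Jacobian. -/
lemma homInner_integrand_eq (s : ℝ) (u : radialTest n) (ξ : Rn n) :
    ‖((‖ξ‖ ^ s : ℝ) : ℂ) * fourierU (u : Rn n → ℂ) ξ‖ ^ 2 =
      (fun η : Rn n => ((2 * Real.pi) ^ n)⁻¹ * (angFreq η ^ (2 * s) * ‖𝓕 (toSchwartz u) η‖ ^ 2))
        ((2 * Real.pi)⁻¹ • ξ) := by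
  have hpi : 0 < 2 * Real.pi := by positivity
  simp only
  rw [fourierU_eq, norm_mul, norm_mul, Complex.norm_real, Complex.norm_real,
    Real.norm_of_nonneg (by positivity), Real.norm_of_nonneg (by positivity),
    angFreq_smul (by positivity), angFreq, inv_mul_cancel_left₀ hpi.ne', mul_pow, mul_pow,
    ← Real.rpow_natCast, ← Real.rpow_mul (norm_nonneg _), ← Real.rpow_natCast (_ ^ _),
    ← Real.rpow_mul hpi.le, ← Real.rpow_natCast (2 * Real.pi) n, ← Real.rpow_neg hpi.le]
  push_cast
  rw [mul_comm s 2, div_mul_cancel₀ _ (by norm_num : (2 : ℝ) ≠ 0)]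
  ring

lemma re_homInner_self (s : ℝ) (u : radialTest n) :
    (homInner s (u : Rn n → ℂ) u).re = ∫ η, angFreq η ^ (2 * s) * ‖𝓕 (toSchwartz u) η‖ ^ 2 := by
  have hpi : 0 < 2 * Real.pi := by positivity
  rw [homInner_self, Complex.ofReal_re]
  simp only [homInner_integrand_eq]
  rw [Measure.integral_comp_smul_of_nonneg volume (fun η : Rn n => ((2 * Real.pi) ^ n)⁻¹ *
    (angFreq η ^ (2 * s) * ‖𝓕 (toSchwartz u) η‖ ^ 2)) _ (hR := by positivity), integral_const_mul,
    finrank_euclideanSpace_fin, inv_pow, inv_inv, smul_eq_mul, mul_inv_cancel_left₀ (by positivity)]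

lemma integrable_angFreq_rpow_mul {s : ℝ} (hs : 0 ≤ s) (u : radialTest n) :
    Integrable fun η : Rn n => angFreq η ^ (2 * s) * ‖𝓕 (toSchwartz u) η‖ ^ 2 := by
  have hpi : 0 < 2 * Real.pi := by positivity
  have h1 : Integrable fun ξ : Rn n => ‖((‖ξ‖ ^ s : ℝ) : ℂ) * fourierU (u : Rn n → ℂ) ξ‖ ^ 2 := by
    refine (integrable_homInner hs u u).norm.congr (Eventually.of_forall fun ξ => ?_)
    simp only
    rw [norm_mul, RCLike.norm_conj, sq]
  simp only [homInner_integrand_eq] at h1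
  rw [integrable_comp_smul_iff volume (fun η : Rn n => ((2 * Real.pi) ^ n)⁻¹ *
    (angFreq η ^ (2 * s) * ‖𝓕 (toSchwartz u) η‖ ^ 2)) (inv_ne_zero hpi.ne')] at h1
  exact (integrable_const_mul_iff (IsUnit.mk0 _ (by positivity)) _).1 h1

open Classical in
lemma re_interInner_self {a b : ℝ} (ha : 0 ≤ a) (hab : a ≤ b) (u : radialTest n) :
    Integrable (fun η : Rn n => (angFreq η ^ (2 * a) + if a < b then angFreq η ^ (2 * b) else 0) *
      ‖𝓕 (toSchwartz u) η‖ ^ 2) ∧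
    (interInner a b (u : Rn n → ℂ) u).re =
      ∫ η, (angFreq η ^ (2 * a) + if a < b then angFreq η ^ (2 * b) else 0) *
        ‖𝓕 (toSchwartz u) η‖ ^ 2 := by
  have i1 := integrable_angFreq_rpow_mul ha u
  have i2 := integrable_angFreq_rpow_mul (ha.trans hab) u
  unfold interInner
  split_ifs
  · simp only [add_mul]
    exact ⟨i1.add i2, by rw [integral_add i1 i2, Complex.add_re, re_homInner_self, re_homInner_self]⟩
  · simp only [add_zero]
    exact ⟨i1, re_homInner_self a u⟩

/-- The norm of `ℋ^{s₁,s₂}` in terms of half-wave amplitudes. -/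
lemma norm_halfWaveLp_pairSchwartz (h : Exponents n s₁ s₂) (u : TestPair h) :
    ‖halfWaveLp h (pairSchwartz h u)‖ = ‖u‖ := by
  have hone := h.one_le
  have hle := h.le
  rw [← sq_eq_sq₀ (norm_nonneg _) (norm_nonneg _)]
  have e1 : ‖u‖ ^ 2 = (interInner s₁ s₂ (u.1 : Rn n → ℂ) u.1).re +
      (interInner (s₁ - 1) (s₂ - 1) (u.2 : Rn n → ℂ) u.2).re := by
    rw [← inner_self_eq_norm_sq (𝕜 := ℂ)]
    rfl
  obtain ⟨i1, j1⟩ := re_interInner_self (by linarith) hle u.1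
  obtain ⟨i2, j2⟩ := re_interInner_self (a := s₁ - 1) (b := s₂ - 1) (by linarith) (by linarith) u.2
  rw [e1, j1, j2, ← integral_add i1 i2]
  refine (norm_toLp_two_sq (memLp_halfWave h (pairSchwartz h u))).trans ?_
  rw [integral_freqMeasure]
  refine integral_congr_ae (Eventually.of_forall fun η => ?_)
  simp only
  rw [halfWave, norm_halfAmp_sq]
  -- Splitting off ρ² is valid at ρ = 0 too because 2(s - 1) ≥ 0. It turns the weight for u₁ into
  -- the weight for u₂ times ρ².
  have hr : ∀ s : ℝ, 1 ≤ s → angFreq η ^ (2 * s) = angFreq η ^ (2 * (s - 1)) * angFreq η ^ 2 := by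
    intro s hs
    rw [← Real.rpow_natCast, ← Real.rpow_add_of_nonneg (angFreq_nonneg η) (by linarith) (by simp)]
    congr 1
    push_cast
    ring
  rw [freqWeight, hr s₁ hone, hr s₂ (hone.trans hle)]
  simp only [sub_lt_sub_iff_right]
  change _ * (angFreq η ^ 2 * ‖𝓕 (toSchwartz u.1) η‖ ^ 2 + ‖𝓕 (toSchwartz u.2) η‖ ^ 2) = _
  split_ifs <;> ring

end Norm

/-! ### A smooth step function -/

section Step

/-- A smooth step, `0` on `(-∞, 1]` and `1` on `[2, ∞)`. -/
def smoothStep (s : ℝ) : ℝ := Real.smoothTransition (s - 1)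

lemma contDiff_smoothStep : ContDiff ℝ ∞ smoothStep :=
  Real.smoothTransition.contDiff.comp (contDiff_id.sub contDiff_const)

lemma smoothStep_of_le {s : ℝ} (hs : s ≤ 1) : smoothStep s = 0 :=
  Real.smoothTransition.zero_of_nonpos (by linarith)

lemma smoothStep_of_ge {s : ℝ} (hs : 2 ≤ s) : smoothStep s = 1 :=
  Real.smoothTransition.one_of_one_le (by linarith)

lemma smoothStep_nonneg (s : ℝ) : 0 ≤ smoothStep s := Real.smoothTransition.nonneg _

lemma smoothStep_le_one (s : ℝ) : smoothStep s ≤ 1 := Real.smoothTransition.le_one _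

lemma deriv_smoothStep_of_lt {s : ℝ} (hs : s < 1) : deriv smoothStep s = 0 := by
  have : smoothStep =ᶠ[𝓝 s] fun _ => 0 := by
    filter_upwards [Iio_mem_nhds hs] with t ht using smoothStep_of_le (le_of_lt ht)
  rw [this.deriv_eq, deriv_const]

lemma deriv_smoothStep_of_gt {s : ℝ} (hs : 2 < s) : deriv smoothStep s = 0 := by
  have : smoothStep =ᶠ[𝓝 s] fun _ => 1 := by
    filter_upwards [Ioi_mem_nhds hs] with t ht using smoothStep_of_ge (le_of_lt ht)
  rw [this.deriv_eq, deriv_const]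

/-- The derivative vanishes off [1, 2]. The factor s makes the bound scale invariant, as needed for
cutoffs at all radii. -/
lemma exists_bound_mul_deriv_smoothStep : ∃ C, 0 ≤ C ∧ ∀ s, |s * deriv smoothStep s| ≤ C := by
  have hc : Continuous fun s : ℝ => s * deriv smoothStep s :=
    continuous_id.mul (contDiff_smoothStep.continuous_deriv (by simp))
  obtain ⟨C, hC⟩ := (isCompact_Icc (a := (1 : ℝ)) (b := 2)).exists_bound_of_continuousOn
    hc.continuousOn
  have hC0 : 0 ≤ C := (norm_nonneg _).trans (hC 1 (by norm_num))
  refine ⟨C, hC0, fun s => ?_⟩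
  by_cases h1 : s < 1
  · simpa [deriv_smoothStep_of_lt h1]
  by_cases h2 : 2 < s
  · simpa [deriv_smoothStep_of_gt h2]
  exact hC s ⟨not_lt.1 h1, not_lt.1 h2⟩

end Step

/-! ### Approximation of radial Schwartz functions by test functions -/

section SpatialCutoff

/-- A smooth radial cutoff, `1` on the unit ball. -/
def cutoff (x : Rn n) : ℝ := 1 - smoothStep (‖x‖ ^ 2)

lemma contDiff_cutoff : ContDiff ℝ ∞ (cutoff : Rn n → ℝ) :=
  contDiff_const.sub (contDiff_smoothStep.comp (contDiff_norm_sq ℝ))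

lemma hasCompactSupport_cutoff : HasCompactSupport (cutoff : Rn n → ℝ) := by
  refine HasCompactSupport.of_support_subset_isCompact (isCompact_closedBall (0 : Rn n) 2) ?_
  intro x hx
  by_contra h
  have h2 : 2 < ‖x‖ := by simpa using h
  refine hx ?_
  rw [cutoff, smoothStep_of_ge (by nlinarith), sub_self]

lemma exists_bound_iteratedFDeriv_cutoff_sub_one (i : ℕ) :
    ∃ M, 0 ≤ M ∧ ∀ x : Rn n, ‖iteratedFDeriv ℝ i (fun x => cutoff x - 1) x‖ ≤ M := by
  obtain ⟨C, hC⟩ := ((contDiff_cutoff (n := n)).continuous_iteratedFDeriv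
    (m := i) (by exact_mod_cast le_top)).bounded_above_of_compact_support
      (hasCompactSupport_cutoff.iteratedFDeriv (𝕜 := ℝ) i)
  refine ⟨C + 1, by linarith [(norm_nonneg _).trans (hC 0)], fun x => ?_⟩
  have e : iteratedFDeriv ℝ i (fun x : Rn n => cutoff x - 1) x =
      iteratedFDeriv ℝ i cutoff x - iteratedFDeriv ℝ i (fun _ => (1 : ℝ)) x :=
    iteratedFDeriv_sub_apply (contDiff_cutoff.of_le (by exact_mod_cast le_top)).contDiffAt
      contDiff_const.contDiffAt
  rw [e]
  refine (norm_sub_le _ _).trans (add_le_add (hC x) ?_)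
  rcases Nat.eq_zero_or_pos i with rfl | hi
  · simp
  · rw [iteratedFDeriv_const_of_ne hi.ne']
    simp

/-- The function and its derivatives vanish where c‖x‖ < 1; elsewhere the factor c‖x‖ ≥ 1 comes for
free. It trades one power of ‖x‖ for a small constant c. -/
lemma exists_bound_iteratedFDeriv_cutoff_smul (i : ℕ) : ∃ M, 0 ≤ M ∧ ∀ c : ℝ, 0 ≤ c → c ≤ 1 →
    ∀ x : Rn n, ‖iteratedFDeriv ℝ i (fun x => cutoff (c • x) - 1) x‖ ≤ M * (c * ‖x‖) := by
  obtain ⟨M, hM, hb⟩ := exists_bound_iteratedFDeriv_cutoff_sub_one (n := n) i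
  refine ⟨M, hM, fun c hc hc1 x => ?_⟩
  have hcont : ContDiff ℝ i (fun x : Rn n => cutoff x - 1) :=
    (contDiff_cutoff.of_le (by exact_mod_cast le_top)).sub contDiff_const
  have e := congrFun (iteratedFDeriv_comp_const_smul (𝕜 := ℝ) c hcont) x
  rw [e, norm_smul, Real.norm_of_nonneg (by positivity)]
  have hcx : ‖c • x‖ = c * ‖x‖ := by rw [norm_smul, Real.norm_of_nonneg hc]
  by_cases hlt : ‖c • x‖ < 1
  · have hev : (fun x : Rn n => cutoff x - 1) =ᶠ[𝓝 (c • x)] fun _ => 0 := by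
      filter_upwards [(isOpen_lt continuous_norm continuous_const).mem_nhds hlt] with y hy
      have hy' : ‖y‖ < 1 := hy
      rw [cutoff, smoothStep_of_le (by nlinarith [norm_nonneg y])]
      simp
    rw [(hev.iteratedFDeriv ℝ i).eq_of_nhds]
    simp only [iteratedFDeriv_fun_zero, Pi.zero_apply, norm_zero, mul_zero]
    positivity
  · rw [not_lt, hcx] at hlt
    calc c ^ i * ‖iteratedFDeriv ℝ i (fun x => cutoff x - 1) (c • x)‖ ≤ 1 * M := by
          gcongr
          · exact pow_le_one₀ hc hc1
          · exact hb _
      _ = M * 1 := by ring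
      _ ≤ M * (c * ‖x‖) := by gcongr

/-- The truncation of a radial Schwartz function. -/
def truncate (f : 𝓢(Rn n, ℂ)) (hf : ∀ x y : Rn n, ‖x‖ = ‖y‖ → f x = f y) (c : ℝ) (hc : c ≠ 0) :
    radialTest n :=
  ⟨fun x => cutoff (c • x) • f x,
    (contDiff_cutoff.comp (contDiff_const_smul c)).smul (f.smooth ⊤),
    HasCompactSupport.smul_right (f := fun x : Rn n => cutoff (c • x))
      (hasCompactSupport_cutoff.comp_homeomorph (Homeomorph.smulOfNeZero c hc)),
    fun x y h => by
      simp only [cutoff, norm_smul, h, hf x y h]⟩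

/-- Radial test functions are dense among radial Schwartz functions. -/
lemma exists_tendsto_toSchwartz (f : 𝓢(Rn n, ℂ)) (hf : ∀ x y : Rn n, ‖x‖ = ‖y‖ → f x = f y) :
    ∃ φ : ℕ → radialTest n, Tendsto (fun k => toSchwartz (φ k)) atTop (𝓝 f) := by
  have hc0 : ∀ k : ℕ, (1 / ((k : ℝ) + 1)) ≠ 0 := fun k => by positivity
  refine ⟨fun k => truncate f hf (1 / ((k : ℝ) + 1)) (hc0 k), ?_⟩
  rw [(schwartz_withSeminorms ℝ (Rn n) ℂ).tendsto_nhds]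
  rintro ⟨p, l⟩ ε hε
  choose M hM hMb using exists_bound_iteratedFDeriv_cutoff_smul (n := n)
  -- The seminorm of order p + 1 pays for the extra power of ‖x‖.
  set B := ∑ i ∈ Finset.range (l + 1), (l.choose i : ℝ) * M i *
    SchwartzMap.seminorm ℝ (p + 1) (l - i) f with hB
  have hB0 : 0 ≤ B := Finset.sum_nonneg fun i _ =>
    mul_nonneg (mul_nonneg (by positivity) (hM i)) (apply_nonneg _ _)
  have hlim : Tendsto (fun k : ℕ => 1 / ((k : ℝ) + 1) * B) atTop (𝓝 0) := by
    simpa using tendsto_one_div_add_atTop_nhds_zero_nat.mul_const B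
  filter_upwards [hlim.eventually_lt_const hε] with k hk
  refine lt_of_le_of_lt ?_ hk
  set c := 1 / ((k : ℝ) + 1) with hc
  have hcpos : 0 ≤ c := by positivity
  have hc1 : c ≤ 1 := by rw [hc, div_le_one (by positivity)]; linarith [Nat.cast_nonneg (α := ℝ) k]
  refine SchwartzMap.seminorm_le_bound ℝ p l _ (by positivity) fun x => ?_
  have e : ⇑(toSchwartz (truncate f hf c (hc0 k)) - f) = fun x => (cutoff (c • x) - 1) • f x := by
    funext y
    rw [sub_smul, one_smul]
    rfl
  rw [e]
  have hg : ContDiff ℝ ∞ fun x : Rn n => cutoff (c • x) - 1 :=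
    (contDiff_cutoff.comp (contDiff_const_smul c)).sub contDiff_const
  have h1 := norm_iteratedFDeriv_smul_le hg (f.smooth ⊤) x (n := l) (by exact_mod_cast le_top)
  calc ‖x‖ ^ p * ‖iteratedFDeriv ℝ l (fun x => (cutoff (c • x) - 1) • f x) x‖
      ≤ ‖x‖ ^ p * ∑ i ∈ Finset.range (l + 1), (l.choose i : ℝ) *
          ‖iteratedFDeriv ℝ i (fun x => cutoff (c • x) - 1) x‖ *
          ‖iteratedFDeriv ℝ (l - i) f x‖ := by gcongr
    _ ≤ ‖x‖ ^ p * ∑ i ∈ Finset.range (l + 1), (l.choose i : ℝ) * (M i * (c * ‖x‖)) *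
          ‖iteratedFDeriv ℝ (l - i) f x‖ := by
        gcongr with i _
        exact hMb i c hcpos hc1 x
    _ = c * ∑ i ∈ Finset.range (l + 1), (l.choose i : ℝ) * M i *
          (‖x‖ ^ (p + 1) * ‖iteratedFDeriv ℝ (l - i) f x‖) := by
        rw [Finset.mul_sum, Finset.mul_sum]
        refine Finset.sum_congr rfl fun i _ => ?_
        ring
    _ ≤ c * B := by
        refine mul_le_mul_of_nonneg_left (Finset.sum_le_sum fun i _ => ?_) hcpos
        refine mul_le_mul_of_nonneg_left ?_ (mul_nonneg (by positivity) (hM i))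
        exact SchwartzMap.le_seminorm ℝ (p + 1) (l - i) f x

end SpatialCutoff

/-! ### Radial symmetry and smoothness at the origin -/

section Radial

/-- The reflection exchanging x and y is an isometry that fixes f, and the Fourier transform
commutes with isometries. -/
lemma fourier_radial {f : Rn n → ℂ} (hf : ∀ x y : Rn n, ‖x‖ = ‖y‖ → f x = f y) {x y : Rn n}
    (hxy : ‖x‖ = ‖y‖) : 𝓕 f x = 𝓕 f y := by
  let R : Rn n ≃ₗᵢ[ℝ] Rn n := (ℝ ∙ (x - y))ᗮ.reflection
  have hR : R x = y := Submodule.reflection_sub hxy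
  have hfR : f ∘ R = f := funext fun z => hf _ _ (R.norm_map z)
  rw [← hR, ← Real.fourier_comp_linearIsometry, hfR]

lemma fourierInv_radial {f : Rn n → ℂ} (hf : ∀ x y : Rn n, ‖x‖ = ‖y‖ → f x = f y) {x y : Rn n}
    (hxy : ‖x‖ = ‖y‖) : 𝓕⁻ f x = 𝓕⁻ f y := by
  let R : Rn n ≃ₗᵢ[ℝ] Rn n := (ℝ ∙ (x - y))ᗮ.reflection
  have hR : R x = y := Submodule.reflection_sub hxy
  have hfR : f ∘ R = f := funext fun z => hf _ _ (R.norm_map z)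
  rw [← hR, ← Real.fourierInv_comp_linearIsometry, hfR]

lemma halfWave_radial (h : Exponents n s₁ s₂) (u : TestPair h) {x y : Rn n} (hxy : ‖x‖ = ‖y‖) :
    halfWave (pairSchwartz h u) x = halfWave (pairSchwartz h u) y := by
  have h1 : 𝓕 (toSchwartz u.1) x = 𝓕 (toSchwartz u.1) y := by
    rw [SchwartzMap.fourier_coe]
    exact fourier_radial u.1.2.2.2 hxy
  have h2 : 𝓕 (toSchwartz u.2) x = 𝓕 (toSchwartz u.2) y := by
    rw [SchwartzMap.fourier_coe]
    exact fourier_radial u.2.2.2.2 hxy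
  change halfAmp (angFreq x) (𝓕 (toSchwartz u.1) x) (𝓕 (toSchwartz u.2) x) =
    halfAmp (angFreq y) (𝓕 (toSchwartz u.1) y) (𝓕 (toSchwartz u.2) y)
  rw [h1, h2, angFreq, angFreq, hxy]

/-- A function that is smooth off the origin and vanishes near the origin is smooth. -/
lemma contDiff_of_vanish {E : Type*} [NormedAddCommGroup E] [NormedSpace ℝ E] {f : Rn n → E}
    (hf : ∀ η, η ≠ 0 → ContDiffAt ℝ ∞ f η) {r : ℝ} (hr : 0 < r) (h0 : ∀ η, f η ≠ 0 → r ≤ ‖η‖) :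
    ContDiff ℝ ∞ f := by
  rw [contDiff_iff_contDiffAt]
  intro η
  by_cases hη : η = 0
  · have hev : f =ᶠ[𝓝 η] fun _ => 0 := by
      filter_upwards [Metric.ball_mem_nhds η hr] with ζ hζ
      by_contra hne
      rw [hη, mem_ball_zero_iff] at hζ
      exact absurd (h0 ζ hne) (not_le.2 hζ)
    exact contDiffAt_const.congr_of_eventuallyEq hev
  · exact hf η hη

end Radial

/-! ### Recovering radial Schwartz pairs from annular amplitudes -/

section Synthesis

lemma exists_schwartz_of_annulus {f : Rn n → ℂ} (hf : ∀ η, η ≠ 0 → ContDiffAt ℝ ∞ f η)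
    {r R : ℝ} (hr : 0 < r) (h0 : ∀ η, f η ≠ 0 → r ≤ ‖η‖ ∧ ‖η‖ ≤ R)
    (hrad : ∀ x y : Rn n, ‖x‖ = ‖y‖ → f x = f y) :
    ∃ u : 𝓢(Rn n, ℂ), ⇑(𝓕 u : 𝓢(Rn n, ℂ)) = f ∧ ∀ x y : Rn n, ‖x‖ = ‖y‖ → u x = u y := by
  have hs := contDiff_of_vanish hf hr fun η hη => (h0 η hη).1
  have hc : HasCompactSupport f := by
    refine HasCompactSupport.of_support_subset_isCompact (isCompact_closedBall (0 : Rn n) R) ?_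
    intro η hη
    simpa using (h0 η hη).2
  refine ⟨𝓕⁻ (hc.toSchwartzMap hs), ?_, fun x y hxy => ?_⟩
  · rw [FourierTransform.fourier_fourierInv_eq]
    rfl
  · rw [SchwartzMap.fourierInv_coe]
    exact fourierInv_radial hrad hxy

/-- Every annular amplitude comes from a pair of radial Schwartz functions. -/
lemma exists_halfWave_eq (b : annular n) : ∃ u : 𝓢(Rn n, ℂ) × 𝓢(Rn n, ℂ),
    halfWave u = b ∧ (∀ x y : Rn n, ‖x‖ = ‖y‖ → u.1 x = u.1 y) ∧
      ∀ x y : Rn n, ‖x‖ = ‖y‖ → u.2 x = u.2 y := by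
  obtain ⟨b, hb, ⟨r, hr, R, hR⟩, hrad⟩ := b
  set c : ℂ := ((√2 : ℝ) : ℂ)⁻¹ with hc
  have hcc : c * c * 2 = 1 := by
    rw [hc, ← mul_inv, ← Complex.ofReal_mul, Real.mul_self_sqrt zero_le_two]
    norm_num
  have hbi : ∀ i, ContDiff ℝ ∞ fun η => b η i := fun i =>
    (PiLp.proj (𝕜 := ℝ) 2 (fun _ : Fin 2 => ℂ) i).contDiff.comp hb
  -- p and q solve the 2×2 linear system defining the amplitudes. Dividing by ρ is harmless because
  -- b vanishes near the origin.
  let p : Rn n → ℂ := fun η => c * (angFreq η : ℂ)⁻¹ *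
    ∑ i, Complex.exp (halfSign i * Complex.I * angFreq η) * b η i
  let q : Rn n → ℂ := fun η => c *
    ∑ i, -(halfSign i * Complex.I) * Complex.exp (halfSign i * Complex.I * angFreq η) * b η i
  have hrad' : ∀ x y : Rn n, ‖x‖ = ‖y‖ → angFreq x = angFreq y := fun x y h => by
    rw [angFreq, angFreq, h]
  have hp : ∀ η, p η ≠ 0 → r ≤ ‖η‖ ∧ ‖η‖ ≤ R := fun η hη => hR η fun h0 => hη (by simp [p, h0])
  have hq : ∀ η, q η ≠ 0 → r ≤ ‖η‖ ∧ ‖η‖ ≤ R := fun η hη => hR η fun h0 => hη (by simp [q, h0])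
  obtain ⟨u, hu, hur⟩ := exists_schwartz_of_annulus (f := p) (fun η hη => by
      have h1 := contDiffAt_ofReal_angFreq hη
      have h2 : (angFreq η : ℂ) ≠ 0 := by exact_mod_cast (angFreq_pos hη).ne'
      refine (contDiffAt_const.mul (h1.inv h2)).mul (ContDiffAt.sum fun i _ => ?_)
      exact (contDiffAt_const.mul h1).cexp.mul (hbi i).contDiffAt) hr hp
    (fun x y h => by simp only [p, hrad' x y h, hrad x y h])
  obtain ⟨v, hv, hvr⟩ := exists_schwartz_of_annulus (f := q) (fun η hη => by
      have h1 := contDiffAt_ofReal_angFreq hη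
      refine contDiffAt_const.mul (ContDiffAt.sum fun i _ => ?_)
      exact (contDiffAt_const.mul (contDiffAt_const.mul h1).cexp).mul (hbi i).contDiffAt) hr hq
    (fun x y h => by simp only [q, hrad' x y h, hrad x y h])
  refine ⟨(u, v), ?_, hur, hvr⟩
  funext η
  ext j
  rw [halfWave, halfAmp_apply]
  simp only [hu, hv]
  by_cases hη : η = 0
  · have h0 : b η = 0 := by
      by_contra hne
      have := (hR η hne).1
      rw [hη, norm_zero] at this
      linarith
    simp [p, q, h0]
  · have h2 : (angFreq η : ℂ) ≠ 0 := by exact_mod_cast (angFreq_pos hη).ne'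
    have e1 : (angFreq η : ℂ) * p η = c *
        ∑ i, Complex.exp (halfSign i * Complex.I * angFreq η) * b η i := by
      simp only [p]
      rw [mul_comm c, mul_assoc, mul_inv_cancel_left₀ h2]
    have e2 : Complex.exp (-(halfSign j * Complex.I * angFreq η)) *
        Complex.exp (halfSign j * Complex.I * angFreq η) = 1 := by
      rw [← Complex.exp_add, neg_add_cancel, Complex.exp_zero]
    have e3 : (angFreq η : ℂ) * p η + halfSign j * Complex.I * q η =
        2 * c * Complex.exp (halfSign j * Complex.I * angFreq η) * b η j := by
      rw [e1]
      simp only [q, Fin.sum_univ_two]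
      have hI := Complex.I_mul_I
      fin_cases j
      · simp only [halfSign, Fin.zero_eta, Matrix.cons_val_zero, Matrix.cons_val_one]
        linear_combination (-(c * Complex.exp (1 * Complex.I * angFreq η) * b η 0) +
          c * Complex.exp (-1 * Complex.I * angFreq η) * b η 1) * hI
      · simp only [halfSign, Fin.mk_one, Matrix.cons_val_zero, Matrix.cons_val_one]
        linear_combination (c * Complex.exp (1 * Complex.I * angFreq η) * b η 0 -
          c * Complex.exp (-1 * Complex.I * angFreq η) * b η 1) * hI
    rw [e3, ← hc]
    linear_combination (c * c * 2 * b η j) * e2 + b η j * hcc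

end Synthesis

/-! ### Cutting amplitudes off to annuli -/

section FrequencyCutoff

/-- A smooth cutoff to an annulus `1/k ≤ ‖η‖² ≤ 2k`. -/
def annulusCutoff (k : ℝ) (η : Rn n) : ℝ :=
  smoothStep (k * ‖η‖ ^ 2) * (1 - smoothStep (k⁻¹ * ‖η‖ ^ 2))

lemma contDiff_annulusCutoff (k : ℝ) : ContDiff ℝ ∞ (annulusCutoff k : Rn n → ℝ) :=
  (contDiff_smoothStep.comp (contDiff_const.mul (contDiff_norm_sq ℝ))).mul
    (contDiff_const.sub (contDiff_smoothStep.comp (contDiff_const.mul (contDiff_norm_sq ℝ))))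

lemma annulusCutoff_nonneg (k : ℝ) (η : Rn n) : 0 ≤ annulusCutoff k η :=
  mul_nonneg (smoothStep_nonneg _) (sub_nonneg.2 (smoothStep_le_one _))

lemma annulusCutoff_le_one (k : ℝ) (η : Rn n) : annulusCutoff k η ≤ 1 :=
  mul_le_one₀ (smoothStep_le_one _) (sub_nonneg.2 (smoothStep_le_one _))
    (sub_le_self _ (smoothStep_nonneg _))

lemma annulusCutoff_ne_zero {k : ℝ} (hk : 0 < k) {η : Rn n} (h : annulusCutoff k η ≠ 0) :
    √k⁻¹ ≤ ‖η‖ ∧ ‖η‖ ≤ √(2 * k) := by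
  constructor
  · refine Real.sqrt_le_iff.2 ⟨norm_nonneg _, ?_⟩
    by_contra hlt
    rw [not_le, lt_inv_comm₀ (by_contra fun h0 => h ?_) hk] at hlt
    · refine h ?_
      have h1 : k * ‖η‖ ^ 2 ≤ 1 := by
        have h2 : 0 < ‖η‖ ^ 2 := by
          by_contra h0
          have : ‖η‖ ^ 2 = 0 := le_antisymm (not_lt.1 h0) (by positivity)
          rw [this, inv_zero] at hlt
          linarith
        rw [lt_inv_comm₀ hk h2, ← one_div, lt_div_iff₀ hk] at hlt
        linarith
      rw [annulusCutoff, smoothStep_of_le h1, zero_mul]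
    · have : ‖η‖ ^ 2 = 0 := le_antisymm (not_lt.1 h0) (by positivity)
      rw [annulusCutoff, this, mul_zero, smoothStep_of_le zero_le_one, zero_mul]
  · refine Real.le_sqrt_of_sq_le ?_
    by_contra hlt
    refine h ?_
    have : 2 ≤ k⁻¹ * ‖η‖ ^ 2 := by
      rw [inv_mul_eq_div, le_div_iff₀ hk]
      linarith
    rw [annulusCutoff, smoothStep_of_ge this, sub_self, mul_zero]

lemma fderiv_annulusCutoff (k : ℝ) (η : Rn n) : fderiv ℝ (annulusCutoff k) η η =
    2 * ((k * ‖η‖ ^ 2) * deriv smoothStep (k * ‖η‖ ^ 2)) * (1 - smoothStep (k⁻¹ * ‖η‖ ^ 2)) -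
    2 * smoothStep (k * ‖η‖ ^ 2) * ((k⁻¹ * ‖η‖ ^ 2) * deriv smoothStep (k⁻¹ * ‖η‖ ^ 2)) := by
  have h1 : ∀ a : ℝ, HasFDerivAt (fun η : Rn n => smoothStep (a * ‖η‖ ^ 2))
      (deriv smoothStep (a * ‖η‖ ^ 2) • (a • (2 • innerSL ℝ η))) η := fun a =>
    HasDerivAt.comp_hasFDerivAt (h₂ := smoothStep) (f := fun η : Rn n => a * ‖η‖ ^ 2) η
      ((contDiff_smoothStep.differentiable (by simp)) (a * ‖η‖ ^ 2)).hasDerivAt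
      ((hasStrictFDerivAt_norm_sq η).hasFDerivAt.const_mul a)
  have h2 := (h1 k).mul ((h1 k⁻¹).const_sub 1)
  have h3 : fderiv ℝ (annulusCutoff k) η = _ := h2.fderiv
  rw [h3]
  simp only [FunLike.coe_add, FunLike.coe_smul, Pi.add_apply,
    Pi.smul_apply, innerSL_apply_apply, real_inner_self_eq_norm_sq, smul_eq_mul, FunLike.coe_neg,
    Pi.neg_apply]
  simp only [nsmul_eq_mul, Nat.cast_ofNat]
  ring

/-- The bound is uniform in k because η·∇ is scale invariant: it acts on a function θ(a‖η‖²) as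
2sθ'(s) at s = a‖η‖². -/
lemma exists_bound_fderiv_annulusCutoff :
    ∃ C, 0 ≤ C ∧ ∀ k (η : Rn n), |fderiv ℝ (annulusCutoff k) η η| ≤ C := by
  obtain ⟨C, hC, hb⟩ := exists_bound_mul_deriv_smoothStep
  refine ⟨4 * C, by positivity, fun k η => ?_⟩
  rw [fderiv_annulusCutoff]
  set a := k * ‖η‖ ^ 2
  set a' := k⁻¹ * ‖η‖ ^ 2
  have h1 := hb a
  have h2 := hb a'
  have e1 : |1 - smoothStep a'| ≤ 1 := by
    rw [abs_of_nonneg (sub_nonneg.2 (smoothStep_le_one _))]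
    exact sub_le_self _ (smoothStep_nonneg _)
  have e2 : |smoothStep a| ≤ 1 := by
    rw [abs_of_nonneg (smoothStep_nonneg _)]
    exact smoothStep_le_one _
  refine (abs_sub _ _).trans ?_
  rw [abs_mul, abs_mul, abs_mul (2 * smoothStep a), abs_mul 2 (smoothStep a), abs_two]
  have f1 := mul_le_mul h1 e1 (abs_nonneg _) hC
  have f2 := mul_le_mul e2 h2 (abs_nonneg _) zero_le_one
  linarith

lemma eventually_annulusCutoff {η : Rn n} (hη : η ≠ 0) :
    ∀ᶠ k : ℝ in atTop, annulusCutoff k η = 1 ∧ fderiv ℝ (annulusCutoff k) η η = 0 := by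
  have hp : 0 < ‖η‖ ^ 2 := by have := norm_pos_iff.2 hη; positivity
  filter_upwards [eventually_gt_atTop (2 / ‖η‖ ^ 2), eventually_gt_atTop (‖η‖ ^ 2)] with k h1 h2
  rw [div_lt_iff₀ hp] at h1
  have hk : 0 < k := hp.trans h2
  have h3 : k⁻¹ * ‖η‖ ^ 2 < 1 := by
    rw [inv_mul_eq_div, div_lt_one hk]
    exact h2
  rw [fderiv_annulusCutoff, annulusCutoff, smoothStep_of_ge h1.le, smoothStep_of_le h3.le,
    deriv_smoothStep_of_gt h1, deriv_smoothStep_of_lt h3]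
  simp

/-- The half-wave amplitudes of a test pair, cut off to an annulus. -/
def cutHalfWave (h : Exponents n s₁ s₂) (u : TestPair h) (k : ℕ) : annular n :=
  ⟨fun η => annulusCutoff ((k : ℝ) + 1) η • halfWave (pairSchwartz h u) η, by
    have hk : 0 < (k : ℝ) + 1 := by positivity
    have hsupp : ∀ η, annulusCutoff ((k : ℝ) + 1) η • halfWave (pairSchwartz h u) η ≠ 0 →
        √((k : ℝ) + 1)⁻¹ ≤ ‖η‖ ∧ ‖η‖ ≤ √(2 * ((k : ℝ) + 1)) := fun η hη =>
      annulusCutoff_ne_zero hk (left_ne_zero_of_smul hη)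
    refine ⟨contDiff_of_vanish (fun η hη => ?_) (r := √((k : ℝ) + 1)⁻¹) (by positivity)
      fun η hη => (hsupp η hη).1, ⟨_, by positivity, _, hsupp⟩, fun x y hxy => ?_⟩
    · exact (contDiff_annulusCutoff _).contDiffAt.smul (contDiffAt_halfWave _ hη)
    · simp only [annulusCutoff, hxy, halfWave_radial h u hxy]⟩

/-- Leibniz rule: the cut-off image under the wave operator, plus a commutator containing only η·∇
of the cutoff. -/
lemma dilateGen_cutHalfWave (h : Exponents n s₁ s₂) (u : TestPair h) (k : ℕ) {η : Rn n}
    (hη : η ≠ 0) : (dilateGen n (cutHalfWave h u k) : Rn n → Amp) η =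
      annulusCutoff ((k : ℝ) + 1) η • halfWave (pairSchwartz h (freeWave h u)) η +
      fderiv ℝ (annulusCutoff ((k : ℝ) + 1)) η η • halfWave (pairSchwartz h u) η := by
  have h1 := ((contDiff_annulusCutoff ((k : ℝ) + 1)).differentiable (by simp) η).hasFDerivAt
  have h2 := ((contDiffAt_halfWave (pairSchwartz h u) hη).differentiableAt (by simp)).hasFDerivAt
  have h3 := (h1.smul h2).fderiv
  have h4 : fderiv ℝ (cutHalfWave h u k : Rn n → Amp) η = _ := h3
  rw [dilateGen_apply, h4, pairSchwartz_freeWave, halfWave_waveSchwartz _ hη]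
  simp only [cutHalfWave, FunLike.coe_add, FunLike.coe_smul, Pi.add_apply, Pi.smul_apply,
    ContinuousLinearMap.smulRight_apply, smul_add, smul_comm ((n : ℝ) - 3)]
  abel

lemma ae_ne_zero (h : Exponents n s₁ s₂) : ∀ᵐ η ∂(freqMeasure h), η ≠ 0 := by
  have : Nonempty (Fin n) := ⟨⟨0, h.one_le_dim⟩⟩
  have : Nontrivial (Rn n) := inferInstance
  exact (freqMeasure_absolutelyContinuous h).ae_le (Measure.ae_ne volume 0)

lemma tendsto_natCast_add_one : Tendsto (fun k : ℕ => (k : ℝ) + 1) atTop atTop :=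
  tendsto_atTop_add_const_right _ _ tendsto_natCast_atTop_atTop

lemma tendsto_cutHalfWave (h : Exponents n s₁ s₂) (u : TestPair h) :
    Tendsto (fun k => annularToLp h (cutHalfWave h u k)) atTop
      (𝓝 (halfWaveLp h (pairSchwartz h u))) := by
  refine tendsto_toLp_two_of_dominated (fun k => memLp_annular h _) (memLp_halfWave h _)
    (memLp_halfWave h (pairSchwartz h u)).norm (Eventually.of_forall fun k =>
      Eventually.of_forall fun η => ?_) ?_
  · have h0 := annulusCutoff_nonneg ((k : ℝ) + 1) η
    have h1 := annulusCutoff_le_one ((k : ℝ) + 1) η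
    have e : (cutHalfWave h u k : Rn n → Amp) η - halfWave (pairSchwartz h u) η =
        (annulusCutoff ((k : ℝ) + 1) η - 1) • halfWave (pairSchwartz h u) η := by
      rw [sub_smul, one_smul]
      rfl
    rw [e, norm_smul]
    refine mul_le_of_le_one_left (norm_nonneg _) ?_
    rw [Real.norm_eq_abs, abs_le]
    constructor <;> linarith
  · filter_upwards [ae_ne_zero h] with η hη
    refine tendsto_const_nhds.congr' ?_
    filter_upwards [tendsto_natCast_add_one.eventually (eventually_annulusCutoff hη)] with k hk
    simp [cutHalfWave, hk.1]

/-- The commutator is dominated by a constant times the amplitude, uniformly in k, and at each η ≠ 0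
it vanishes for large k. -/
lemma tendsto_dilateGen_cutHalfWave (h : Exponents n s₁ s₂) (u : TestPair h) :
    Tendsto (fun k => annularToLp h (dilateGen n (cutHalfWave h u k))) atTop
      (𝓝 (halfWaveLp h (pairSchwartz h (freeWave h u)))) := by
  obtain ⟨C, hC, hb⟩ := exists_bound_fderiv_annulusCutoff (n := n)
  refine tendsto_toLp_two_of_dominated (fun k => memLp_annular h _) (memLp_halfWave h _)
    ((memLp_halfWave h (pairSchwartz h (freeWave h u))).norm.add
      ((memLp_halfWave h (pairSchwartz h u)).norm.const_mul C)) (Eventually.of_forall fun k => ?_) ?_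
  · filter_upwards [ae_ne_zero h] with η hη
    have h0 := annulusCutoff_nonneg ((k : ℝ) + 1) η
    have h1 := annulusCutoff_le_one ((k : ℝ) + 1) η
    have e : (dilateGen n (cutHalfWave h u k) : Rn n → Amp) η -
        halfWave (pairSchwartz h (freeWave h u)) η =
        (annulusCutoff ((k : ℝ) + 1) η - 1) • halfWave (pairSchwartz h (freeWave h u)) η +
        fderiv ℝ (annulusCutoff ((k : ℝ) + 1)) η η • halfWave (pairSchwartz h u) η := by
      rw [dilateGen_cutHalfWave h u k hη, sub_smul, one_smul]
      abel
    rw [e]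
    refine (norm_add_le _ _).trans (add_le_add ?_ ?_)
    · rw [norm_smul]
      refine mul_le_of_le_one_left (norm_nonneg _) ?_
      rw [Real.norm_eq_abs, abs_le]
      constructor <;> linarith
    · rw [norm_smul]
      exact mul_le_mul_of_nonneg_right (hb _ _) (norm_nonneg _)
  · filter_upwards [ae_ne_zero h] with η hη
    refine tendsto_const_nhds.congr' ?_
    filter_upwards [tendsto_natCast_add_one.eventually (eventually_annulusCutoff hη)] with k hk
    rw [dilateGen_cutHalfWave h u k hη, hk.1, hk.2, one_smul, zero_smul, add_zero]

end FrequencyCutoff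

/-! ### Transfer to `HSpace` and identification of the generator -/

lemma denseRange_incl (h : Exponents n s₁ s₂) : DenseRange (incl h) :=
  UniformSpace.Completion.denseRange_coe

lemma norm_incl (h : Exponents n s₁ s₂) (u : TestPair h) : ‖incl h u‖ = ‖u‖ :=
  UniformSpace.Completion.norm_coe u

/-- The half-wave representation of `ℋ^{s₁,s₂}` as a subspace of a weighted `L²` space. -/
def halfWaveIsometry (h : Exponents n s₁ s₂) : HSpace h →ₗᵢ[ℂ] Lp Amp 2 (freqMeasure h) where
  toLinearMap := ((halfWaveLp h ∘ₗ pairSchwartz h).extendOfNorm (incl h)).toLinearMap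
  norm_map' x := by
    refine (denseRange_incl h).induction_on x (isClosed_eq (by fun_prop) continuous_norm) fun u => ?_
    have e := LinearMap.extendOfNorm_eq (f := halfWaveLp h ∘ₗ pairSchwartz h) (denseRange_incl h)
      ⟨1, fun v => by
        rw [one_mul, norm_incl]
        exact (norm_halfWaveLp_pairSchwartz h v).le⟩ u
    rw [ContinuousLinearMap.coe_coe, e, norm_incl]
    exact norm_halfWaveLp_pairSchwartz h u

lemma halfWaveIsometry_incl (h : Exponents n s₁ s₂) (u : TestPair h) :
    halfWaveIsometry h (incl h u) = halfWaveLp h (pairSchwartz h u) :=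
  LinearMap.extendOfNorm_eq (f := halfWaveLp h ∘ₗ pairSchwartz h) (denseRange_incl h)
    ⟨1, fun v => by
      rw [one_mul, norm_incl]
      exact (norm_halfWaveLp_pairSchwartz h v).le⟩ u

/-- Annular amplitudes are limits of test pairs in the graph norm. -/
lemma exists_tendsto_annular (h : Exponents n s₁ s₂) (b : annular n) : ∃ φ : ℕ → TestPair h,
    Tendsto (fun k => halfWaveIsometry h (incl h (φ k))) atTop (𝓝 (annularToLp h b)) ∧
    Tendsto (fun k => halfWaveIsometry h (incl h (freeWave h (φ k)))) atTop
      (𝓝 (annularToLp h (dilateGen n b))) := by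
  obtain ⟨u, hu, hr₁, hr₂⟩ := exists_halfWave_eq b
  obtain ⟨φ₁, h₁⟩ := exists_tendsto_toSchwartz u.1 hr₁
  obtain ⟨φ₂, h₂⟩ := exists_tendsto_toSchwartz u.2 hr₂
  let φ : ℕ → TestPair h := fun k => (φ₁ k, φ₂ k)
  have hφ : Tendsto (fun k => pairSchwartz h (φ k)) atTop (𝓝 u) := h₁.prodMk_nhds h₂
  have e1 : annularToLp h b = halfWaveLp h u := by
    refine MemLp.toLp_congr (memLp_annular h b) (memLp_halfWave h u) (Eventually.of_forall fun η => ?_)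
    rw [hu]
  have e2 : annularToLp h (dilateGen n b) = halfWaveLp h (waveSchwartz u) := by
    refine MemLp.toLp_congr (memLp_annular h _) (memLp_halfWave h _) ?_
    filter_upwards [ae_ne_zero h] with η hη
    rw [halfWave_waveSchwartz u hη, dilateGen_apply, hu]
  refine ⟨φ, ?_, ?_⟩
  · simp only [halfWaveIsometry_incl, e1]
    exact ((continuous_halfWaveLp h).tendsto u).comp hφ
  · simp only [halfWaveIsometry_incl, pairSchwartz_freeWave, e2]
    exact (((continuous_halfWaveLp h).comp continuous_waveSchwartz).tendsto u).comp hφ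

lemma annularToLp_mem_range (h : Exponents n s₁ s₂) (b : annular n) :
    annularToLp h b ∈ LinearMap.range (halfWaveIsometry h).toLinearMap := by
  obtain ⟨φ, hφ, -⟩ := exists_tendsto_annular h b
  have hc : IsClosed (Set.range (halfWaveIsometry h)) :=
    (halfWaveIsometry h).isometry.isClosedEmbedding.isClosed_range
  exact hc.mem_of_tendsto hφ (Eventually.of_forall fun k => ⟨_, rfl⟩)

/-- The vector of `ℋ^{s₁,s₂}` with the given annular amplitude. -/
def annularVec (h : Exponents n s₁ s₂) : annular n →ₗ[ℂ] HSpace h :=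
  (LinearEquiv.ofInjective (halfWaveIsometry h).toLinearMap
    (halfWaveIsometry h).injective).symm.toLinearMap ∘ₗ
      (annularToLp h).codRestrict _ (annularToLp_mem_range h)

lemma halfWaveIsometry_annularVec (h : Exponents n s₁ s₂) (b : annular n) :
    halfWaveIsometry h (annularVec h b) = annularToLp h b :=
  congrArg Subtype.val ((LinearEquiv.ofInjective (halfWaveIsometry h).toLinearMap
    (halfWaveIsometry h).injective).apply_symm_apply ⟨annularToLp h b, annularToLp_mem_range h b⟩)

lemma norm_annularVec (h : Exponents n s₁ s₂) (b : annular n) :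
    ‖annularVec h b‖ = ‖annularToLp h b‖ := by
  rw [← halfWaveIsometry_annularVec, LinearIsometry.norm_map]

lemma tendsto_halfWaveIsometry_iff (h : Exponents n s₁ s₂) {ι : Type*} {l : Filter ι}
    {f : ι → HSpace h} {x : HSpace h} :
    Tendsto (fun i => halfWaveIsometry h (f i)) l (𝓝 (halfWaveIsometry h x)) ↔
      Tendsto f l (𝓝 x) :=
  (halfWaveIsometry h).isometry.isEmbedding.tendsto_nhds_iff.symm

lemma tendsto_annularVec_cutHalfWave (h : Exponents n s₁ s₂) (u : TestPair h) :
    Tendsto (fun k => annularVec h (cutHalfWave h u k)) atTop (𝓝 (incl h u)) := by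
  rw [← tendsto_halfWaveIsometry_iff]
  simp only [halfWaveIsometry_annularVec, halfWaveIsometry_incl]
  exact tendsto_cutHalfWave h u

lemma denseRange_annularVec (h : Exponents n s₁ s₂) : DenseRange (annularVec h) := by
  refine dense_closure.1 ((denseRange_incl h).mono ?_)
  rintro _ ⟨u, rfl⟩
  exact mem_closure_of_tendsto (tendsto_annularVec_cutHalfWave h u)
    (Eventually.of_forall fun k => ⟨_, rfl⟩)

lemma mem_graph_freeOp (h : Exponents n s₁ s₂) (p : HSpace h × HSpace h) :
    p ∈ (freeOp h).graph ↔ ∃ u : TestPair h, p = (incl h u, incl h (freeWave h u)) := by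
  have key : ∀ u, freeOp h ⟨incl h u, ⟨u, rfl⟩⟩ = incl h (freeWave h u) := by
    intro u
    have : (LinearEquiv.ofInjective (incl h) (incl_injective h)).symm ⟨incl h u, ⟨u, rfl⟩⟩ = u :=
      (LinearEquiv.ofInjective (incl h) (incl_injective h)).symm_apply_apply u
    change incl h (freeWave h ((LinearEquiv.ofInjective (incl h) (incl_injective h)).symm
      ⟨incl h u, ⟨u, rfl⟩⟩)) = _
    rw [this]
  rw [LinearPMap.mem_graph_iff]
  constructor
  · rintro ⟨⟨_, u, rfl⟩, h1, h2⟩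
    exact ⟨u, Prod.ext h1.symm (h2.symm.trans (key u))⟩
  · rintro ⟨u, rfl⟩
    exact ⟨⟨incl h u, u, rfl⟩, rfl, key u⟩

/-- The closures of the free wave operator and of the dilation generator agree. -/
lemma topologicalClosure_graph_freeOp (h : Exponents n s₁ s₂) :
    (freeOp h).graph.topologicalClosure =
      (LinearMap.range ((annularVec h).prod (annularVec h ∘ₗ dilateGen n))).topologicalClosure := by
  refine le_antisymm (Submodule.topologicalClosure_minimal _ ?_
    (Submodule.isClosed_topologicalClosure _)) (Submodule.topologicalClosure_minimal _ ?_
    (Submodule.isClosed_topologicalClosure _))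
  · intro p hp
    obtain ⟨u, rfl⟩ := (mem_graph_freeOp h p).1 hp
    have h2 : Tendsto (fun k => annularVec h (dilateGen n (cutHalfWave h u k))) atTop
        (𝓝 (incl h (freeWave h u))) := by
      rw [← tendsto_halfWaveIsometry_iff]
      simp only [halfWaveIsometry_annularVec, halfWaveIsometry_incl]
      exact tendsto_dilateGen_cutHalfWave h u
    exact mem_closure_of_tendsto ((tendsto_annularVec_cutHalfWave h u).prodMk_nhds h2)
      (Eventually.of_forall fun k => ⟨_, rfl⟩)
  · rintro _ ⟨b, rfl⟩
    obtain ⟨φ, h1, h2⟩ := exists_tendsto_annular h b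
    rw [← halfWaveIsometry_annularVec, tendsto_halfWaveIsometry_iff] at h1 h2
    exact mem_closure_of_tendsto (h1.prodMk_nhds h2)
      (Eventually.of_forall fun k => (mem_graph_freeOp h _).2 ⟨φ k, rfl⟩)

theorem freeOp_generates (h : Exponents n s₁ s₂) :
    (freeOp h).IsClosable ∧ ∃ S : ℝ≥0 → HSpace h →L[ℂ] HSpace h,
      IsC0Semigroup S ∧ IsGenerator (freeOp h).closure S ∧
      ∀ (τ : ℝ≥0) (u : HSpace h), ‖S τ u‖ ≤ Real.exp (((n : ℝ) / 2 - 2 - s₁) * τ) * ‖u‖ := by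
  obtain ⟨S, hS, hb, hgen⟩ := exists_semigroup_of_core (annularVec h) (denseRange_annularVec h)
    (dilate n) (dilateGen n) ((n : ℝ) / 2 - 2 - s₁) dilate_zero dilate_add
    (fun τ b => by
      rw [norm_annularVec, norm_annularVec]
      exact norm_annularToLp_dilate_le h τ b)
    (fun b => by
      rw [← tendsto_halfWaveIsometry_iff]
      simp only [map_smul, map_sub, halfWaveIsometry_annularVec]
      exact tendsto_dilate h b)
  rw [← topologicalClosure_graph_freeOp] at hgen
  have hcl : (freeOp h).IsClosable := by
    refine ⟨(freeOp h).graph.topologicalClosure.toLinearPMap,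
      (Submodule.toLinearPMap_graph_eq _ ?_).symm⟩
    rintro ⟨x, y⟩ hxy (rfl : x = 0)
    exact tendsto_nhds_unique ((hgen _ _).1 hxy) (by simp)
  refine ⟨hcl, S, hS, fun x y => ?_, hb⟩
  rw [← hcl.graph_closure_eq_closure_graph]
  exact hgen x y

end SimilarityWave

end

theorem proposition3p1 (n : ℕ) (s₁ s₂ : ℝ) (hn : 3 ≤ n) (h₁ : 1 < s₁) (h₁' : s₁ < (n : ℝ) / 2)
    (h₁₂ : s₁ ≤ s₂) :
    (SimilarityWave.freeOp (SimilarityWave.Exponents.of_lt hn h₁ h₁₂)).IsClosable ∧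
    ∃ S₀ : ℝ≥0 → SimilarityWave.HSpace (SimilarityWave.Exponents.of_lt hn h₁ h₁₂) →L[ℂ]
        SimilarityWave.HSpace (SimilarityWave.Exponents.of_lt hn h₁ h₁₂),
      SimilarityWave.IsC0Semigroup S₀ ∧
      SimilarityWave.IsGenerator
        (SimilarityWave.freeOp (SimilarityWave.Exponents.of_lt hn h₁ h₁₂)).closure S₀ ∧
      ∀ (τ : ℝ≥0) (u : SimilarityWave.HSpace (SimilarityWave.Exponents.of_lt hn h₁ h₁₂)),
        ‖S₀ τ u‖ ≤ Real.exp (((n : ℝ) / 2 - 2 - s₁) * τ) * ‖u‖ :=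
  SimilarityWave.freeOp_generates (SimilarityWave.Exponents.of_lt hn h₁ h₁₂)
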